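/- Let $M_k$ denote the complex $k\times k$ matrices with inner product $\langle C,D\rangle=\mathrm{tr}(CD^*)$, and identify $M_k\otimes M_m$ with $M_{km}$ via the Kronecker product. **Definitions.** A *Hermitian Schmidt decomposition* of $A\in M_k\otimes M_m$ is a decomposition $A=\sum_{i=1}^n\lambda_i\,\gamma_i\otimes\delta_i$ with all $\lambda_i>0$ and with $\gamma_1,\dots,\gamma_n\in M_k$ and $\delta_1,\dots,\delta_n\in M_m$ orthonormal families of Hermitian matrices. A positive semidefinite Hermitian $A\in M_k\otimes M_k$ is *SPC* if it has a Hermitian Schmidt decomposition with $\gamma_i=\delta_i$ for all $i$; a positive semidefinite Hermitian $A\in M_k\otimes M_m$ is *PPT* if its partial transpose $A^{t_1}=((\cdot)^t\otimes \mathrm{Id})(A)$ is also positive semidefinite. A positive semidefinite Hermitian $A\in M_k\otimes M_m$ is *weak irreducible* if for all Hermitian projections $V_1,V_2\in M_k$ and $W_1,W_2\in M_m$ with $V_1V_2=0$, $W_1W_2=0$, $V_1+V_2=\mathrm{Id}$, $W_1+W_2=\mathrm{Id}$, the equality $A=\sum_{i=1}^2(V_i\otimes W_i)A(V_i\otimes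 W_i)$ implies $(V_1\otimes W_1)A(V_1\otimes W_1)=0$ or $(V_2\otimes W_2)A(V_2\otimes W_2)=0$. *Split decomposition of a nonzero PPT matrix $A$.* Take a Hermitian Schmidt decomposition $A=\sum_{i=1}^n\lambda_i\gamma_i\otimes\delta_i$ with $\lambda_1=\dots=\lambda_s>\lambda_{s+1}\ge\dots\ge\lambda_n$, and a Hermitian Schmidt decomposition $\sum_{i=1}^s\gamma_i\otimes\delta_i=\sum_{i=1}^s\gamma_i'\otimes\delta_i'$ with all $\gamma_i',\delta_i'$ positive semidefinite. For $i\le s$ let $V_i$, $W_i$ be the Hermitian projections onto the images of $\gamma_i'$, $\delta_i'$, and let $V_{s+1}$, $W_{s+1}$ be the Hermitian projections onto the orthogonal complements of $\sum_{i\le s}\Im(\gamma_i')$ and $\sum_{i\le s}\Im(\delta_i')$. The terms of the split decomposition are $(V_i\otimes W_i)A(V_i\otimes W_i)$, $1\le i\le s+1$. For a nonzero SPC matrix the same construction is made with $\gamma_i=\delta_i$, $\gamma'_i=\delta'_i$, hence $V_i=W_i$. *Iterated split decomposition.* Its pieces form a list: the empty list if $A=0$; otherwise the first $s$ terms of a split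 decomposition of $A$, followed by the pieces of an iterated split decomposition of the last term $(V_{s+1}\otimes W_{s+1})A(V_{s+1}\otimes W_{s+1})$. **Statement.** Every SPC (respectively PPT) matrix $A$ has an iterated split decomposition. For every iterated split decomposition of $A$, with pieces $A_1,\dots,A_r$, one has $A=A_1+\dots+A_r$, each $A_j$ is nonzero, SPC (respectively PPT) and weak irreducible, and either $A$ itself is weak irreducible or $r\ge2$ (or both). In particular, every SPC (respectively PPT) matrix is weak irreducible or a sum of weak irreducible SPC (respectively PPT) matrices, namely the pieces of its iterated split decomposition. -/

import Mathlib

open scoped Kronecker ComplexOrder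

/-- `M_k`: complex `k × k` matrices. -/
abbrev CMat (k : ℕ) : Type := Matrix (Fin k) (Fin k) ℂ

/-- `M_k ⊗ M_m`, identified with `M_{km}` through the Kronecker product `⊗ₖ`. -/
abbrev BiMat (k m : ℕ) : Type := Matrix (Fin k × Fin m) (Fin k × Fin m) ℂ

/-- `A = ∑ i, lam i • (γ i ⊗ δ i)` is a Hermitian Schmidt decomposition of `A`: the coefficients are
positive, and `γ`, `δ` are families of Hermitian matrices that are orthonormal for the inner product
`⟨C, D⟩ = tr (C D*)`. -/
structure IsHermitianSchmidt {k m n : ℕ} (A : BiMat k m) (lam : Fin n → ℝ)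
    (γ : Fin n → CMat k) (δ : Fin n → CMat m) : Prop where
  pos : ∀ i, 0 < lam i
  herm_left : ∀ i, (γ i).IsHermitian
  herm_right : ∀ i, (δ i).IsHermitian
  orthonormal_left : ∀ i j, (γ i * (γ j).conjTranspose).trace = if i = j then 1 else 0
  orthonormal_right : ∀ i j, (δ i * (δ j).conjTranspose).trace = if i = j then 1 else 0
  eq_sum : A = ∑ i, (lam i : ℂ) • (γ i ⊗ₖ δ i)

/-- SPC (symmetric with positive coefficients) matrices: positive semidefinite Hermitian, with a
Hermitian Schmidt decomposition of the form `∑ i, lam i • (γ i ⊗ γ i)`. -/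
def IsSPC {k : ℕ} (A : BiMat k k) : Prop :=
  A.PosSemidef ∧ ∃ (n : ℕ) (lam : Fin n → ℝ) (γ : Fin n → CMat k), IsHermitianSchmidt A lam γ γ

/-- The partial transposition `(·)ᵗ ⊗ Id`. -/
def partialTranspose {k m : ℕ} (A : BiMat k m) : BiMat k m :=
  Matrix.of fun p q => A (q.1, p.2) (p.1, q.2)

theorem partialTranspose_kronecker {k m : ℕ} (X : CMat k) (Y : CMat m) :
    partialTranspose (X ⊗ₖ Y) = X.transpose ⊗ₖ Y := by
  ext p q
  simp [partialTranspose, Matrix.kroneckerMap_apply]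

/-- PPT (positive under partial transposition) matrices. -/
def IsPPT {k m : ℕ} (A : BiMat k m) : Prop :=
  A.PosSemidef ∧ (partialTranspose A).PosSemidef

/-- The compression `(V ⊗ W) A (V ⊗ W)`. -/
def compress {k m : ℕ} (V : CMat k) (W : CMat m) (A : BiMat k m) : BiMat k m :=
  (V ⊗ₖ W) * A * (V ⊗ₖ W)

/-- Weak irreducible matrices. -/
def IsWeakIrreducible {k m : ℕ} (A : BiMat k m) : Prop :=
  A.PosSemidef ∧
    ∀ (V₁ V₂ : CMat k) (W₁ W₂ : CMat m),
      IsStarProjection V₁ → IsStarProjection V₂ → IsStarProjection W₁ → IsStarProjection W₂ →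
      V₁ * V₂ = 0 → W₁ * W₂ = 0 → V₁ + V₂ = 1 → W₁ + W₂ = 1 →
      A = compress V₁ W₁ A + compress V₂ W₂ A →
      compress V₁ W₁ A = 0 ∨ compress V₂ W₂ A = 0

/-- The image of a matrix, as a subspace of `ℂ^k` with its standard Hermitian inner product. -/
noncomputable def matImage {k : ℕ} (γ : CMat k) : Submodule ℂ (EuclideanSpace ℂ (Fin k)) :=
  LinearMap.range (Matrix.toEuclideanLin γ)

/-- The matrix of the orthogonal (Hermitian) projection of `ℂ^k` onto the subspace `S`. -/
noncomputable def orthProj {k : ℕ} (S : Submodule ℂ (EuclideanSpace ℂ (Fin k))) : CMat k :=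
  Matrix.toEuclideanLin.symm (S.starProjection : EuclideanSpace ℂ (Fin k) →ₗ[ℂ] _)

/-- The Hermitian projection onto the orthogonal complement of the sum of the images of the `γ i`. -/
noncomputable def complProj {k s : ℕ} (γ : Fin s → CMat k) : CMat k :=
  orthProj (⨆ i, matImage (γ i))ᗮ

/-- The data from which a split decomposition of `A` is formed. One starts from a Hermitian Schmidt
decomposition `A = ∑ i, lam i • (γ i ⊗ δ i)` whose coefficients are in decreasing order, the largest
one being repeated exactly `s ≥ 1` times; then `D = ∑ i < s, γ i ⊗ δ i` is written as a Hermitian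
Schmidt decomposition `D = ∑ i, γ' i ⊗ δ' i` with all `γ' i`, `δ' i` positive semidefinite. -/
structure IsSplitData {k m n s : ℕ} (A : BiMat k m) (lam : Fin n → ℝ)
    (γ : Fin n → CMat k) (δ : Fin n → CMat m)
    (γ' : Fin s → CMat k) (δ' : Fin s → CMat m) : Prop where
  schmidt : IsHermitianSchmidt A lam γ δ
  antitone : Antitone lam
  one_le : 1 ≤ s
  le : s ≤ n
  top_eq : ∀ i j : Fin n, (i : ℕ) < s → (j : ℕ) < s → lam i = lam j
  top_gt : ∀ i j : Fin n, (i : ℕ) < s → s ≤ (j : ℕ) → lam j < lam i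
  schmidt_top : IsHermitianSchmidt (∑ i ∈ Finset.univ.filter (fun i : Fin n => (i : ℕ) < s), γ i ⊗ₖ δ i)
    (fun _ : Fin s => (1 : ℝ)) γ' δ'
  posSemidef_left : ∀ i, (γ' i).PosSemidef
  posSemidef_right : ∀ i, (δ' i).PosSemidef

/-- The `i`-th piece `(V_i ⊗ W_i) A (V_i ⊗ W_i)`, `i ≤ s`, of the split decomposition of `A`, where
`V_i`, `W_i` are the Hermitian projections onto the images of `γ' i` and `δ' i`. -/
noncomputable def splitPiece {k m s : ℕ} (A : BiMat k m)
    (γ' : Fin s → CMat k) (δ' : Fin s → CMat m) (i : Fin s) : BiMat k m :=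
  compress (orthProj (matImage (γ' i))) (orthProj (matImage (δ' i))) A

/-- The last term `(V_{s+1} ⊗ W_{s+1}) A (V_{s+1} ⊗ W_{s+1})` of the split decomposition of `A`. -/
noncomputable def splitRemainder {k m s : ℕ} (A : BiMat k m)
    (γ' : Fin s → CMat k) (δ' : Fin s → CMat m) : BiMat k m :=
  compress (complProj γ') (complProj δ') A

/-- `IteratedSplitSPC A L`: `L` is the list of pieces of an iterated split decomposition of the
matrix `A` in the SPC setting (the same matrices in both tensor factors): take the first `s` terms
of the split decomposition of `A`, and continue with its last term as long as that is nonzero. -/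
inductive IteratedSplitSPC {k : ℕ} : BiMat k k → List (BiMat k k) → Prop
  | zero : IteratedSplitSPC 0 []
  | step {n s : ℕ} {A : BiMat k k} {lam : Fin n → ℝ} {γ : Fin n → CMat k} {γ' : Fin s → CMat k}
      {L : List (BiMat k k)} (h : IsSplitData A lam γ γ γ' γ')
      (hL : IteratedSplitSPC (splitRemainder A γ' γ') L) :
      IteratedSplitSPC A (List.ofFn (splitPiece A γ' γ') ++ L)

/-- `IteratedSplitPPT A L`: `L` is the list of pieces of an iterated split decomposition of the
matrix `A` in the PPT setting: take the first `s` terms of the split decomposition of `A`, and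
continue with its last term as long as that is nonzero. -/
inductive IteratedSplitPPT {k m : ℕ} : BiMat k m → List (BiMat k m) → Prop
  | zero : IteratedSplitPPT 0 []
  | step {n s : ℕ} {A : BiMat k m} {lam : Fin n → ℝ} {γ : Fin n → CMat k} {δ : Fin n → CMat m}
      {γ' : Fin s → CMat k} {δ' : Fin s → CMat m}
      {L : List (BiMat k m)} (h : IsSplitData A lam γ δ γ' δ')
      (hL : IteratedSplitPPT (splitRemainder A γ' δ') L) :
      IteratedSplitPPT A (List.ofFn (splitPiece A γ' δ') ++ L)

/-! A matrix `A` is studied through the map `lmap A` from `M_k` to `M_m` defined by the pairing `tr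
(A (X ⊗ Y))`, with transpose `rmap A`. If `A` is positive semidefinite, this map preserves
positivity. A Hermitian Schmidt decomposition is a singular value decomposition of it on the real
space of Hermitian matrices, so the `γ' i` of a split decomposition form a positive semidefinite
orthonormal basis of the space of left singular vectors for the largest singular value `l`.

The key fact is that a positive semidefinite singular pair `(X, Y)` makes `A` block diagonal along
the supports `V`, `W` of `X`, `Y`. Trace orthogonality of positive matrices gives `A (V ⊗ (1 - W)) =
0 = A ((1 - V) ⊗ W)`. The remaining corner `(V ⊗ W) A ((1 - V) ⊗ (1 - W))` vanishes by moving to the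
partial transpose (`IsPPT.splitsAlong`) or by a sum of squares (`IsSPC.splitsAlong`). Hence `A` is
the sum of its split terms (`IsSplitData.sum_eq`).

A piece is weak irreducible because a block decomposition of it would cut `γ' i` to another top
singular vector supported inside `supp (γ' i)`. Such a vector is `c • γ' i` with `c * c = c`, so one
of the two blocks is zero (`IsSplitData.isWeakIrreducible_splitPiece`).

Existence of the positive basis rests on a Perron-Frobenius argument: replacing a top singular
vector by its absolute value does not decrease the Rayleigh quotient, so the top space is closed
under positive parts (`IsHermitianSchmidt.isPosLattice`), and induction on dimension yields the
basis (`IsPosLattice.exists_orthonormal`). Iteration stops because the kernel of `A` grows strictly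
(`IsSplitData.ker_mulLeft_lt`). -/

/-! ### The maps between matrix spaces attached to a bipartite matrix, and block splittings -/

section Pairing

open Matrix

/-- The linear map `M_k → M_m` attached to `A ∈ M_k ⊗ M_m`: `tr (A (X ⊗ Y)) = tr (lmap A X * Y)`. -/
def lmap {k m : ℕ} (A : BiMat k m) : CMat k →ₗ[ℂ] CMat m where
  toFun X := Matrix.of fun a b => ∑ p, ∑ q, A (p, a) (q, b) * X q p
  map_add' X Y := by
    ext a b
    simp [mul_add, Finset.sum_add_distrib]
  map_smul' c X := by
    ext a b
    simp only [Matrix.smul_apply, Matrix.of_apply, smul_eq_mul, RingHom.id_apply, Finset.mul_sum]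
    exact Finset.sum_congr rfl fun p _ => Finset.sum_congr rfl fun q _ => by ring

/-- The linear map `M_m → M_k` attached to `A ∈ M_k ⊗ M_m`: `tr (A (X ⊗ Y)) = tr (rmap A Y * X)`. -/
def rmap {k m : ℕ} (A : BiMat k m) : CMat m →ₗ[ℂ] CMat k :=
  lmap (A.submatrix Prod.swap Prod.swap)

variable {k m : ℕ}

theorem trace_mul_kronecker_eq_lmap (A : BiMat k m) (X : CMat k) (Y : CMat m) :
    (A * (X ⊗ₖ Y)).trace = (lmap A X * Y).trace := by
  simp only [Matrix.trace, Matrix.diag, Matrix.mul_apply, lmap, LinearMap.coe_mk, AddHom.coe_mk,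
    Matrix.of_apply, Matrix.kroneckerMap_apply, Fintype.sum_prod_type, Finset.sum_mul]
  rw [Finset.sum_comm]
  refine Finset.sum_congr rfl fun a _ => ?_
  conv_lhs => enter [2, p]; rw [Finset.sum_comm]
  rw [Finset.sum_comm]
  exact Finset.sum_congr rfl fun b _ => Finset.sum_congr rfl fun p _ =>
    Finset.sum_congr rfl fun q _ => by ring

theorem trace_mul_kronecker_eq_rmap (A : BiMat k m) (X : CMat k) (Y : CMat m) :
    (A * (X ⊗ₖ Y)).trace = (rmap A Y * X).trace := by
  rw [rmap, ← trace_mul_kronecker_eq_lmap]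
  simp only [Matrix.trace, Matrix.diag, Matrix.mul_apply, Matrix.submatrix_apply,
    Matrix.kroneckerMap_apply, Fintype.sum_prod_type, Prod.swap_prod_mk]
  rw [Finset.sum_comm]
  refine Finset.sum_congr rfl fun a _ => Finset.sum_congr rfl fun b _ => ?_
  rw [Finset.sum_comm]
  exact Finset.sum_congr rfl fun b _ => Finset.sum_congr rfl fun p _ => by ring

theorem trace_rmap_mul (A : BiMat k m) (X : CMat k) (Y : CMat m) :
    (rmap A Y * X).trace = (lmap A X * Y).trace := by
  rw [← trace_mul_kronecker_eq_rmap, trace_mul_kronecker_eq_lmap]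

theorem lmap_injective {A B : BiMat k m} (h : ∀ X, lmap A X = lmap B X) : A = B := by
  ext ⟨p, a⟩ ⟨q, b⟩
  have := congrFun (congrFun (h (Matrix.single q p 1)) a) b
  simpa [lmap, Matrix.single_apply, ite_and, Finset.sum_ite_eq] using this

theorem lmap_add_left (A B : BiMat k m) (X : CMat k) : lmap (A + B) X = lmap A X + lmap B X := by
  ext a b
  simp [lmap, add_mul, Finset.sum_add_distrib]

theorem rmap_add_left (A B : BiMat k m) (Y : CMat m) : rmap (A + B) Y = rmap A Y + rmap B Y :=
  lmap_add_left _ _ _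

theorem lmap_kronecker (C : CMat k) (D : CMat m) (X : CMat k) :
    lmap (C ⊗ₖ D) X = (C * X).trace • D := by
  refine Matrix.ext_iff_trace_mul_right.mpr fun Y => ?_
  rw [← trace_mul_kronecker_eq_lmap, ← Matrix.mul_kronecker_mul, Matrix.trace_kronecker]
  simp

theorem lmap_sum_smul_kronecker {n : ℕ} (c : Fin n → ℝ) (C : Fin n → CMat k) (D : Fin n → CMat m)
    (X : CMat k) :
    lmap (∑ i, (c i : ℂ) • (C i ⊗ₖ D i)) X = ∑ i, ((c i : ℂ) * (C i * X).trace) • D i := by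
  have hadd : ∀ s : Finset (Fin n), lmap (∑ i ∈ s, (c i : ℂ) • (C i ⊗ₖ D i)) X =
      ∑ i ∈ s, ((c i : ℂ) * (C i * X).trace) • D i := by
    intro s
    induction s using Finset.induction_on with
    | empty => ext; simp [lmap]
    | insert i s hi ih =>
      rw [Finset.sum_insert hi, Finset.sum_insert hi, lmap_add_left, ih, ← Matrix.smul_kronecker,
        lmap_kronecker, Matrix.smul_mul, Matrix.trace_smul, smul_eq_mul]
  exact hadd _

theorem rmap_sum_smul_kronecker {n : ℕ} (c : Fin n → ℝ) (C : Fin n → CMat k) (D : Fin n → CMat m)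
    (Y : CMat m) :
    rmap (∑ i, (c i : ℂ) • (C i ⊗ₖ D i)) Y = ∑ i, ((c i : ℂ) * (D i * Y).trace) • C i := by
  have : (∑ i, (c i : ℂ) • (C i ⊗ₖ D i)).submatrix Prod.swap Prod.swap =
      ∑ i, (c i : ℂ) • (D i ⊗ₖ C i) := by
    ext p q
    simp [Matrix.sum_apply, Matrix.kroneckerMap_apply, mul_comm]
  rw [rmap, this, lmap_sum_smul_kronecker]

theorem trace_conj_mul {n : ℕ} (V M Y : CMat n) :
    (V * M * V * Y).trace = (M * (V * Y * V)).trace := by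
  rw [Matrix.mul_assoc, Matrix.mul_assoc, Matrix.trace_mul_comm]
  simp only [Matrix.mul_assoc]

theorem lmap_mul_mul (V V' : CMat k) (W W' : CMat m) (A : BiMat k m) (X : CMat k) :
    lmap ((V ⊗ₖ W) * A * (V' ⊗ₖ W')) X = W * lmap A (V' * X * V) * W' := by
  refine Matrix.ext_iff_trace_mul_right.mpr fun Y => ?_
  have h : (W * lmap A (V' * X * V) * W' * Y).trace =
      (lmap A (V' * X * V) * (W' * Y * W)).trace := by
    rw [Matrix.mul_assoc, Matrix.mul_assoc, Matrix.trace_mul_comm]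
    simp only [Matrix.mul_assoc]
  rw [← trace_mul_kronecker_eq_lmap, h, ← trace_mul_kronecker_eq_lmap,
    Matrix.mul_kronecker_mul, Matrix.mul_kronecker_mul]
  rw [Matrix.mul_assoc, Matrix.mul_assoc, Matrix.trace_mul_comm]
  simp only [Matrix.mul_assoc]

theorem lmap_compress (V : CMat k) (W : CMat m) (A : BiMat k m) (X : CMat k) :
    lmap (compress V W A) X = W * lmap A (V * X * V) * W :=
  lmap_mul_mul V V W W A X

theorem rmap_compress (V : CMat k) (W : CMat m) (A : BiMat k m) (Y : CMat m) :
    rmap (compress V W A) Y = V * rmap A (W * Y * W) * V := by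
  refine Matrix.ext_iff_trace_mul_right.mpr fun X => ?_
  rw [trace_rmap_mul, lmap_compress, trace_conj_mul, trace_conj_mul, trace_rmap_mul]

/-- `A` is block diagonal with blocks `V ⊗ W` and `(1 - V) ⊗ (1 - W)`. -/
def SplitsAlong (A : BiMat k m) (V : CMat k) (W : CMat m) : Prop :=
  A = compress V W A + compress (1 - V) (1 - W) A

theorem SplitsAlong.compl {A : BiMat k m} {V : CMat k} {W : CMat m} (h : SplitsAlong A V W) :
    SplitsAlong A (1 - V) (1 - W) := by
  unfold SplitsAlong
  rw [sub_sub_cancel, sub_sub_cancel, add_comm]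
  exact h

theorem SplitsAlong.lmap_eq {A : BiMat k m} {V : CMat k} {W : CMat m} (h : SplitsAlong A V W)
    (X : CMat k) : lmap A X = W * lmap A (V * X * V) * W +
      (1 - W) * lmap A ((1 - V) * X * (1 - V)) * (1 - W) := by
  conv_lhs => rw [h, lmap_add_left, lmap_compress, lmap_compress]

theorem SplitsAlong.rmap_eq {A : BiMat k m} {V : CMat k} {W : CMat m} (h : SplitsAlong A V W)
    (Y : CMat m) : rmap A Y = V * rmap A (W * Y * W) * V +
      (1 - V) * rmap A ((1 - W) * Y * (1 - W)) * (1 - V) := by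
  conv_lhs => rw [h, rmap_add_left, rmap_compress, rmap_compress]

theorem block_left {n : ℕ} {V : CMat n} (hV : IsIdempotentElem V) (P Q : CMat n) :
    V * (V * P * V + (1 - V) * Q * (1 - V)) * V = V * P * V := by
  have h1 : V * V = V := hV
  have h2 : V * (1 - V) = 0 := by rw [mul_sub, h1, mul_one, sub_self]
  calc _ = (V * V) * P * (V * V) + (V * (1 - V)) * Q * (1 - V) * V := by noncomm_ring
    _ = _ := by rw [h1, h2]; simp

theorem conj_conj {n : ℕ} {V : CMat n} (hV : IsIdempotentElem V) (P : CMat n) :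
    V * (V * P * V) * V = V * P * V := by
  have h1 : V * V = V := hV
  calc _ = (V * V) * P * (V * V) := by noncomm_ring
    _ = _ := by rw [h1]

theorem compl_conj_conj {n : ℕ} {V : CMat n} (hV : IsIdempotentElem V) (P : CMat n) :
    (1 - V) * (V * P * V) * (1 - V) = 0 := by
  have h1 : V * V = V := hV
  have h2 : (1 - V) * V = 0 := by rw [sub_mul, h1, one_mul, sub_self]
  rw [← mul_assoc, ← mul_assoc, h2]
  simp

/-- A splitting of `A` makes `lmap A` intertwine the two compressions; this is how compressed
singular vectors are seen to be singular again. -/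
theorem SplitsAlong.lmap_conj {A : BiMat k m} {V : CMat k} {W : CMat m} (h : SplitsAlong A V W)
    (hV : IsIdempotentElem V) (hW : IsIdempotentElem W) (X : CMat k) :
    lmap A (V * X * V) = W * lmap A X * W := by
  rw [h.lmap_eq X, block_left hW, h.lmap_eq (V * X * V), conj_conj hV, compl_conj_conj hV,
    map_zero, mul_zero, zero_mul, add_zero, conj_conj hW]

theorem SplitsAlong.rmap_conj {A : BiMat k m} {V : CMat k} {W : CMat m} (h : SplitsAlong A V W)
    (hV : IsIdempotentElem V) (hW : IsIdempotentElem W) (Y : CMat m) :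
    rmap A (W * Y * W) = V * rmap A Y * V := by
  rw [h.rmap_eq Y, block_left hV, h.rmap_eq (W * Y * W), conj_conj hW, compl_conj_conj hW,
    map_zero, mul_zero, zero_mul, add_zero, conj_conj hV]

theorem conjTranspose_lmap (A : BiMat k m) (X : CMat k) :
    (lmap A X).conjTranspose = lmap A.conjTranspose X.conjTranspose := by
  ext a b
  simp only [lmap, LinearMap.coe_mk, AddHom.coe_mk, Matrix.conjTranspose_apply, Matrix.of_apply,
    star_sum, star_mul']
  exact Finset.sum_comm

theorem isHermitian_lmap {A : BiMat k m} (hA : A.IsHermitian) {X : CMat k} (hX : X.IsHermitian) :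
    (lmap A X).IsHermitian := by
  rw [Matrix.IsHermitian, conjTranspose_lmap, hA.eq, hX.eq]

end Pairing

/-! ### Trace inequalities for positive semidefinite matrices -/

section Positivity

open Matrix

theorem exists_eq_conjTranspose_mul_self {ι : Type*} [Fintype ι] [DecidableEq ι]
    {A : Matrix ι ι ℂ} (hA : A.PosSemidef) : ∃ C : Matrix ι ι ℂ, A = Cᴴ * C := by
  open scoped MatrixOrder in
  exact CStarAlgebra.nonneg_iff_eq_star_mul_self.mp hA.nonneg

variable {ι : Type*} [Fintype ι] {A B : Matrix ι ι ℂ}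

theorem trace_mul_eq_trace_conjTranspose_mul_self (C D : Matrix ι ι ℂ) :
    ((Cᴴ * C) * (Dᴴ * D)).trace = ((D * Cᴴ)ᴴ * (D * Cᴴ)).trace := by
  rw [conjTranspose_mul, conjTranspose_conjTranspose, ← Matrix.mul_assoc,
    Matrix.trace_mul_comm _ D, Matrix.trace_mul_comm (C * Dᴴ)]
  simp only [Matrix.mul_assoc]

theorem trace_mul_nonneg_of_posSemidef [DecidableEq ι] (hA : A.PosSemidef) (hB : B.PosSemidef) :
    0 ≤ (A * B).trace := by
  obtain ⟨C, rfl⟩ := exists_eq_conjTranspose_mul_self hA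
  obtain ⟨D, rfl⟩ := exists_eq_conjTranspose_mul_self hB
  rw [trace_mul_eq_trace_conjTranspose_mul_self]
  exact (posSemidef_conjTranspose_mul_self _).trace_nonneg

/-- With `A = Cᴴ * C` and `B = Dᴴ * D`, the trace is the squared Hilbert-Schmidt norm of `D * Cᴴ`.
-/
theorem mul_eq_zero_of_trace_mul_eq_zero [DecidableEq ι] (hA : A.PosSemidef) (hB : B.PosSemidef)
    (h : (A * B).trace = 0) : A * B = 0 := by
  obtain ⟨C, rfl⟩ := exists_eq_conjTranspose_mul_self hA
  obtain ⟨D, rfl⟩ := exists_eq_conjTranspose_mul_self hB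
  rw [trace_mul_eq_trace_conjTranspose_mul_self, trace_conjTranspose_mul_self_eq_zero_iff] at h
  have h' : C * Dᴴ = 0 := by simpa using congrArg conjTranspose h
  rw [Matrix.mul_assoc, ← Matrix.mul_assoc C, h']
  simp

theorem trace_mul_self_eq_zero_iff (hA : A.IsHermitian) : (A * A).trace = 0 ↔ A = 0 := by
  nth_rw 2 [← hA.eq]
  rw [trace_mul_conjTranspose_self_eq_zero_iff]

theorem trace_mul_self_nonneg (hA : A.IsHermitian) : 0 ≤ (A * A).trace := by
  nth_rw 1 [← hA.eq]
  exact (posSemidef_conjTranspose_mul_self _).trace_nonneg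

theorem im_trace_mul_eq_zero (hA : A.IsHermitian) (hB : B.IsHermitian) :
    (A * B).trace.im = 0 := by
  have h : star (A * B).trace = (A * B).trace := by
    rw [← trace_conjTranspose, conjTranspose_mul, hA.eq, hB.eq, Matrix.trace_mul_comm]
  exact Complex.conj_eq_iff_im.mp h

theorem posSemidef_lmap {k m : ℕ} {A : BiMat k m} (hA : A.PosSemidef) {X : CMat k}
    (hX : X.PosSemidef) : (lmap A X).PosSemidef := by
  refine PosSemidef.of_dotProduct_mulVec_nonneg (isHermitian_lmap hA.1 hX.1) fun v => ?_
  have h := trace_mul_nonneg_of_posSemidef hA (hX.kronecker (posSemidef_vecMulVec_self_star v))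
  rwa [trace_mul_kronecker_eq_lmap, mul_vecMulVec, trace_vecMulVec, dotProduct_comm] at h

theorem exists_posSemidef_sub_posSemidef [DecidableEq ι] (hA : A.IsHermitian) :
    ∃ P N : Matrix ι ι ℂ, P.PosSemidef ∧ N.PosSemidef ∧ A = P - N ∧ P * N = 0 := by
  open scoped MatrixOrder in
  refine ⟨A⁺, A⁻, ?_, ?_, ?_, ?_⟩
  · exact nonneg_iff_posSemidef.mp (CFC.posPart_nonneg A)
  · exact nonneg_iff_posSemidef.mp (CFC.negPart_nonneg A)
  · exact (CFC.posPart_sub_negPart A hA).symm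
  · exact CFC.posPart_mul_negPart A

theorem mul_comm_eq_zero (hA : A.IsHermitian) (hB : B.IsHermitian) (h : A * B = 0) :
    B * A = 0 := by
  simpa [hA.eq, hB.eq] using congrArg conjTranspose h

theorem isHermitian_conj (hB : B.IsHermitian) (hA : A.IsHermitian) : (B * A * B).IsHermitian := by
  rw [IsHermitian, conjTranspose_mul, conjTranspose_mul, hA.eq, hB.eq, Matrix.mul_assoc]

theorem posSemidef_conj (hB : B.IsHermitian) (hA : A.PosSemidef) : (B * A * B).PosSemidef := by
  simpa [hB.eq] using hA.conjTranspose_mul_mul_same B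

end Positivity

/-! ### Support projections -/

section Support

open Matrix

variable {k : ℕ}

theorem orthProj_eq (S : Submodule ℂ (EuclideanSpace ℂ (Fin k))) :
    orthProj S = (Matrix.toEuclideanCLM (n := Fin k) (𝕜 := ℂ)).symm S.starProjection := by
  rw [orthProj, LinearEquiv.symm_apply_eq, ← Matrix.coe_toEuclideanCLM_eq_toEuclideanLin,
    StarAlgEquiv.apply_symm_apply]

theorem isStarProjection_orthProj (S : Submodule ℂ (EuclideanSpace ℂ (Fin k))) :
    IsStarProjection (orthProj S) := by
  rw [orthProj_eq]
  have h := isStarProjection_starProjection (U := S)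
  exact ⟨by rw [IsIdempotentElem, ← map_mul, h.1.eq], 
    ((Matrix.toEuclideanCLM (n := Fin k) (𝕜 := ℂ)).symm.map_star' _).symm.trans (by
      rw [h.2.star_eq]
      rfl)⟩

theorem orthProj_orthogonal (S : Submodule ℂ (EuclideanSpace ℂ (Fin k))) :
    orthProj Sᗮ = 1 - orthProj S := by
  rw [orthProj_eq, orthProj_eq, Submodule.starProjection_orthogonal', map_sub, map_one]

theorem toEuclideanLin_mul (X Y : CMat k) :
    toEuclideanLin (X * Y) = toEuclideanLin X ∘ₗ toEuclideanLin Y := by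
  simp only [← Matrix.coe_toEuclideanCLM_eq_toEuclideanLin, map_mul]
  rfl

theorem toEuclideanLin_orthProj (S : Submodule ℂ (EuclideanSpace ℂ (Fin k))) :
    toEuclideanLin (orthProj S) = (S.starProjection : EuclideanSpace ℂ (Fin k) →ₗ[ℂ] _) := by
  rw [orthProj, LinearEquiv.apply_symm_apply]

theorem orthProj_mul_of_le {S : Submodule ℂ (EuclideanSpace ℂ (Fin k))} {X : CMat k}
    (h : matImage X ≤ S) : orthProj S * X = X := by
  apply toEuclideanLin.injective
  rw [toEuclideanLin_mul, toEuclideanLin_orthProj]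
  ext1 v
  exact Submodule.starProjection_eq_self_iff.mpr (h (LinearMap.mem_range_self _ v))

/-- The Hermitian projection onto the image of `X`. -/
noncomputable def supp (X : CMat k) : CMat k := orthProj (matImage X)

theorem isStarProjection_supp (X : CMat k) : IsStarProjection (supp X) :=
  isStarProjection_orthProj _

theorem isIdempotentElem_supp (X : CMat k) : IsIdempotentElem (supp X) :=
  (isStarProjection_supp X).1

theorem isHermitian_supp (X : CMat k) : (supp X).IsHermitian := (isStarProjection_supp X).2

theorem supp_mul (X : CMat k) : supp X * X = X := orthProj_mul_of_le le_rfl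

theorem mul_supp {X : CMat k} (hX : X.IsHermitian) : X * supp X = X := by
  simpa [hX.eq, (isHermitian_supp X).eq] using congrArg conjTranspose (supp_mul X)

/-- The projection has the same image as `X`, so its columns can be lifted through `X`. This lets
every relation `Y * X = 0` pass to the support. -/
theorem exists_mul_eq_supp (X : CMat k) : ∃ Z : CMat k, X * Z = supp X := by
  have h : ∀ v, ∃ w, toEuclideanLin X w = toEuclideanLin (supp X) v := fun v => by
    have : toEuclideanLin (supp X) v ∈ matImage X := by
      rw [supp, toEuclideanLin_orthProj]
      exact Submodule.starProjection_apply_mem _ _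
    exact this
  choose f hf using h
  refine ⟨Matrix.of fun i j => f (EuclideanSpace.single j 1) i, ?_⟩
  ext i j
  have := congrArg (fun v : EuclideanSpace ℂ (Fin k) => v i) (hf (EuclideanSpace.single j 1))
  simpa [Matrix.mul_apply, toLpLin_apply, mulVec, dotProduct] using this

theorem mul_supp_eq_zero {Y X : CMat k} (h : Y * X = 0) : Y * supp X = 0 := by
  obtain ⟨Z, hZ⟩ := exists_mul_eq_supp X
  rw [← hZ, ← Matrix.mul_assoc, h, Matrix.zero_mul]

theorem supp_mul_eq_zero {Y X : CMat k} (hX : X.IsHermitian) (h : X * Y = 0) :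
    supp X * Y = 0 := by
  have h' : Yᴴ * X = 0 := by simpa [hX.eq] using congrArg conjTranspose h
  simpa [(isHermitian_supp X).eq] using congrArg conjTranspose (mul_supp_eq_zero h')

theorem IsStarProjection.posSemidef {V : CMat k} (hV : IsStarProjection V) : V.PosSemidef := by
  have h : Vᴴ * V = V := by
    rw [show Vᴴ = V from hV.2]
    exact hV.1
  rw [← h]
  exact posSemidef_conjTranspose_mul_self V

theorem isStarProjection_complProj {s : ℕ} (γ : Fin s → CMat k) :
    IsStarProjection (complProj γ) :=
  isStarProjection_orthProj _

/-- Mutually annihilating Hermitian matrices have orthogonal supports, so the supports add up to the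
projection onto the sum of the images. -/
theorem complProj_add_sum_supp {s : ℕ} {γ : Fin s → CMat k} (hγ : ∀ i, (γ i).IsHermitian)
    (h : ∀ i j, i ≠ j → γ i * γ j = 0) : complProj γ + ∑ i, supp (γ i) = 1 := by
  set U := ⨆ i, matImage (γ i) with hU
  have hc : complProj γ = 1 - orthProj U := orthProj_orthogonal U
  have hle : ∀ i, matImage (γ i) ≤ U := le_iSup fun i => matImage (γ i)
  have hl : ∀ i, supp (γ i) * orthProj U = supp (γ i) := fun i => by
    have h1 : orthProj U * supp (γ i) = supp (γ i) := by
      obtain ⟨Z, hZ⟩ := exists_mul_eq_supp (γ i)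
      rw [← hZ, ← Matrix.mul_assoc, orthProj_mul_of_le (hle i)]
    simpa [(isHermitian_supp (γ i)).eq, show (orthProj U)ᴴ = orthProj U from
      (isStarProjection_orthProj U).2] using congrArg conjTranspose h1
  have hr : (∑ i, supp (γ i)) * orthProj U = orthProj U := by
    apply toEuclideanLin.injective
    rw [toEuclideanLin_mul, toEuclideanLin_orthProj]
    ext1 v
    have key : U ≤ LinearMap.eqLocus (toEuclideanLin (∑ i, supp (γ i))) LinearMap.id := by
      refine iSup_le fun j => ?_
      rintro _ ⟨w, rfl⟩
      rw [LinearMap.mem_eqLocus, LinearMap.id_apply, ← LinearMap.comp_apply, ← toEuclideanLin_mul,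
        Finset.sum_mul, Finset.sum_eq_single j, supp_mul]
      · exact fun i _ hij => supp_mul_eq_zero (hγ i) (h i j hij)
      · simp
    exact key (Submodule.starProjection_apply_mem _ _)
  rw [Finset.sum_mul, Finset.sum_congr rfl fun i _ => hl i] at hr
  rw [hr, hc, sub_add_cancel]

end Support

/-! ### Block splitting along a positive singular pair -/

section KeySplitting

open Matrix

variable {k m : ℕ}

/-- The four products of `V`, `1 - V` with `W`, `1 - W` resolve the identity. Two of them are killed
by `A`, and `h₃` with its adjoint removes the corners between the other two. -/
theorem splitsAlong_of_offDiag {A : BiMat k m} (hA : A.IsHermitian) {V : CMat k} {W : CMat m}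
    (hV : V.IsHermitian) (hW : W.IsHermitian) (h₁ : A * (V ⊗ₖ (1 - W)) = 0)
    (h₂ : A * ((1 - V) ⊗ₖ W) = 0) (h₃ : (V ⊗ₖ W) * A * ((1 - V) ⊗ₖ (1 - W)) = 0) :
    SplitsAlong A V W := by
  have hV' : (1 - V).IsHermitian := isHermitian_one.sub hV
  have hW' : (1 - W).IsHermitian := isHermitian_one.sub hW
  have hK : ∀ {X : CMat k} {Y : CMat m}, X.IsHermitian → Y.IsHermitian →
      (X ⊗ₖ Y).IsHermitian := fun hX hY => by
    rw [IsHermitian, conjTranspose_kronecker, hX.eq, hY.eq]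
  have h₄ : ((1 - V) ⊗ₖ (1 - W)) * A * (V ⊗ₖ W) = 0 := by
    simpa [conjTranspose_mul, hA.eq, (hK hV hW).eq, (hK hV' hW').eq, Matrix.mul_assoc]
      using congrArg conjTranspose h₃
  have hsum : V ⊗ₖ W + (1 - V) ⊗ₖ (1 - W) + V ⊗ₖ (1 - W) + (1 - V) ⊗ₖ W =
      (1 : BiMat k m) := by
    rw [add_assoc, add_assoc, add_comm (V ⊗ₖ (1 - W)), ← add_assoc ((1 - V) ⊗ₖ (1 - W)),
      ← kronecker_add, sub_add_cancel, add_comm _ (V ⊗ₖ (1 - W)), ← add_assoc, ← kronecker_add,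
      add_sub_cancel, ← add_kronecker, add_sub_cancel, one_kronecker_one]
  have hr : A * (V ⊗ₖ W + (1 - V) ⊗ₖ (1 - W)) = A := by
    conv_rhs => rw [← mul_one A, ← hsum, mul_add, mul_add, h₁, h₂, add_zero, add_zero]
  have hl : (V ⊗ₖ W + (1 - V) ⊗ₖ (1 - W)) * A = A := by
    simpa [conjTranspose_mul, hA.eq, (hK hV hW).eq, (hK hV' hW').eq] using
      congrArg conjTranspose hr
  unfold SplitsAlong compress
  conv_lhs => rw [← hl, ← hr]
  simp only [add_mul, mul_add, ← Matrix.mul_assoc, h₃, h₄, add_zero, zero_add]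

theorem lmap_partialTranspose (A : BiMat k m) (X : CMat k) :
    lmap (partialTranspose A) X = lmap A Xᵀ := by
  ext a b
  simp only [lmap, partialTranspose, LinearMap.coe_mk, AddHom.coe_mk, of_apply, transpose_apply]
  exact Finset.sum_comm

theorem partialTranspose_mul_mul (V V' : CMat k) (W W' : CMat m) (A : BiMat k m) :
    partialTranspose ((V ⊗ₖ W) * A * (V' ⊗ₖ W')) =
      (V'ᵀ ⊗ₖ W) * partialTranspose A * (Vᵀ ⊗ₖ W') := by
  refine lmap_injective fun X => ?_
  rw [lmap_partialTranspose, lmap_mul_mul, lmap_mul_mul, lmap_partialTranspose]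
  simp only [transpose_mul, transpose_transpose, Matrix.mul_assoc]

theorem partialTranspose_injective {A B : BiMat k m}
    (h : partialTranspose A = partialTranspose B) : A = B := by
  refine lmap_injective fun X => ?_
  rw [← transpose_transpose X, ← lmap_partialTranspose, h, lmap_partialTranspose]

/-- Partial transposition carries the corner to a product with the factor `partialTranspose A * (Vᵀ
⊗ₖ (1 - W))`. That factor is a product of positive matrices whose trace equals `tr (A (V ⊗ (1 - W)))
= 0`, so it vanishes. -/
theorem IsPPT.splitsAlong {A : BiMat k m} (hA : IsPPT A) {V : CMat k} {W : CMat m}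
    (hV : IsStarProjection V) (hW : IsStarProjection W) (h₁ : A * (V ⊗ₖ (1 - W)) = 0)
    (h₂ : A * ((1 - V) ⊗ₖ W) = 0) : SplitsAlong A V W := by
  refine splitsAlong_of_offDiag hA.1.1 hV.2 hW.2 h₁ h₂ (partialTranspose_injective ?_)
  rw [partialTranspose_mul_mul, Matrix.mul_assoc, mul_eq_zero_of_trace_mul_eq_zero hA.2
    (hV.posSemidef.transpose.kronecker hW.one_sub.posSemidef), Matrix.mul_zero]
  · ext; simp [partialTranspose]
  · rw [trace_mul_kronecker_eq_lmap, lmap_partialTranspose, transpose_transpose,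
      ← trace_mul_kronecker_eq_lmap, h₁, trace_zero]

theorem IsPPT.compress {A : BiMat k m} (hA : IsPPT A) {V : CMat k} {W : CMat m}
    (hV : V.IsHermitian) (hW : W.IsHermitian) : IsPPT (compress V W A) := by
  refine ⟨?_, ?_⟩
  · refine posSemidef_conj ?_ hA.1
    rw [IsHermitian, conjTranspose_kronecker, hV.eq, hW.eq]
  · rw [_root_.compress, partialTranspose_mul_mul]
    refine posSemidef_conj ?_ hA.2
    rw [IsHermitian, conjTranspose_kronecker, hV.transpose.eq, hW.eq]

/-- The vanishing block `(V ⊗ (1 - V)) A ((1 - V) ⊗ V)` is a positive combination of the `C i ⊗ (C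
i)ᴴ` with `C i = V * γ i * (1 - V)`. This forces every `C i` to be zero, and the corner is built
from `C i ⊗ C i`. -/
theorem IsSPC.splitsAlong {A : BiMat k k} (hA : IsSPC A) {V : CMat k} (hV : IsStarProjection V)
    (h₁ : A * (V ⊗ₖ (1 - V)) = 0) (h₂ : A * ((1 - V) ⊗ₖ V) = 0) : SplitsAlong A V V := by
  obtain ⟨hpsd, n, lam, γ, h⟩ := hA
  have hsum : ∀ B C D E : CMat k, (B ⊗ₖ C) * A * (D ⊗ₖ E) =
      ∑ i, (lam i : ℂ) • ((B * γ i * D) ⊗ₖ (C * γ i * E)) := fun B C D E => by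
    conv_lhs => rw [h.eq_sum]
    rw [Finset.mul_sum, Finset.sum_mul]
    refine Finset.sum_congr rfl fun i _ => ?_
    rw [mul_smul_comm, smul_mul_assoc, mul_kronecker_mul, mul_kronecker_mul]
  have hVH : Vᴴ = V := hV.2
  have hz : ∀ i, V * γ i * (1 - V) = 0 := by
    have h0 := hsum V (1 - V) (1 - V) V
    rw [Matrix.mul_assoc, h₂, Matrix.mul_zero] at h0
    intro i
    ext p q
    have h1 : ∀ i, (1 - V) * γ i * V = (V * γ i * (1 - V))ᴴ := fun i => by
      simp [conjTranspose_mul, hVH, (h.herm_left i).eq, Matrix.mul_assoc]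
    -- At this entry each Kronecker product contributes the squared modulus of one entry of `V * γ i
    -- * (1 - V)`.
    have h2 := congrFun (congrFun h0 (p, q)) (q, p)
    simp only [h1, Matrix.sum_apply, Matrix.smul_apply, kroneckerMap_apply, conjTranspose_apply,
      Matrix.zero_apply, smul_eq_mul] at h2
    have h3 : ∑ i, lam i * Complex.normSq ((V * γ i * (1 - V)) p q) = 0 := by
      have h4 : ((∑ i, lam i * Complex.normSq ((V * γ i * (1 - V)) p q) : ℝ) : ℂ) = 0 := by
        rw [h2]
        push_cast
        exact Finset.sum_congr rfl fun i _ => by rw [← Complex.mul_conj]; rfl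
      exact_mod_cast h4
    have h5 := (Finset.sum_eq_zero_iff_of_nonneg fun i _ =>
      mul_nonneg (h.pos i).le (Complex.normSq_nonneg _)).mp h3 i (Finset.mem_univ i)
    exact Complex.normSq_eq_zero.mp ((mul_eq_zero.mp h5).resolve_left (h.pos i).ne')
  refine splitsAlong_of_offDiag hpsd.1 hV.2 hV.2 h₁ h₂ ?_
  rw [hsum]
  exact Finset.sum_eq_zero fun i _ => by rw [hz, zero_kronecker, smul_zero]

/-- A pair of positive semidefinite singular vectors is supported on a diagonal block. -/
theorem mul_supp_kronecker_eq_zero {A : BiMat k m} (hA : A.PosSemidef) {X : CMat k} {Y : CMat m}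
    (hX : X.PosSemidef) {c : ℂ} (h : lmap A X = c • Y) :
    A * (supp X ⊗ₖ (1 - supp Y)) = 0 := by
  have h0 : A * (X ⊗ₖ (1 - supp Y)) = 0 := by
    -- The trace in question is `c * tr (Y * (1 - supp Y))`, which is zero.
    refine mul_eq_zero_of_trace_mul_eq_zero hA
      (hX.kronecker (isStarProjection_supp Y).one_sub.posSemidef) ?_
    rw [trace_mul_kronecker_eq_lmap, h, smul_mul_assoc, trace_smul, trace_mul_comm, sub_mul,
      one_mul, supp_mul, sub_self, trace_zero, smul_zero]
  obtain ⟨Z, hZ⟩ := exists_mul_eq_supp X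
  rw [← hZ, ← Matrix.mul_one (1 - supp Y), mul_kronecker_mul, ← Matrix.mul_assoc, h0,
    Matrix.zero_mul]

theorem mul_kronecker_supp_eq_zero {A : BiMat k m} (hA : A.PosSemidef) {X : CMat k} {Y : CMat m}
    (hY : Y.PosSemidef) {c : ℂ} (h : rmap A Y = c • X) :
    A * ((1 - supp X) ⊗ₖ supp Y) = 0 := by
  have h0 : A * ((1 - supp X) ⊗ₖ Y) = 0 := by
    refine mul_eq_zero_of_trace_mul_eq_zero hA
      ((isStarProjection_supp X).one_sub.posSemidef.kronecker hY) ?_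
    rw [trace_mul_kronecker_eq_rmap, h, smul_mul_assoc, trace_smul, trace_mul_comm, sub_mul,
      one_mul, supp_mul, sub_self, trace_zero, smul_zero]
  obtain ⟨Z, hZ⟩ := exists_mul_eq_supp Y
  rw [← hZ, ← Matrix.mul_one (1 - supp X), mul_kronecker_mul, ← Matrix.mul_assoc, h0,
    Matrix.zero_mul]

end KeySplitting

/-! ### Hermitian Schmidt decompositions as singular value decompositions -/

section Schmidt

open Matrix

variable {k m n : ℕ} {A : BiMat k m} {lam : Fin n → ℝ} {γ : Fin n → CMat k} {δ : Fin n → CMat m}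

theorem IsHermitianSchmidt.swap (h : IsHermitianSchmidt A lam γ δ) :
    IsHermitianSchmidt (A.submatrix Prod.swap Prod.swap) lam δ γ where
  pos := h.pos
  herm_left := h.herm_right
  herm_right := h.herm_left
  orthonormal_left := h.orthonormal_right
  orthonormal_right := h.orthonormal_left
  eq_sum := by
    conv_lhs => rw [h.eq_sum]
    ext p q
    simp [Matrix.sum_apply, Matrix.kroneckerMap_apply, mul_comm]

theorem IsHermitianSchmidt.trace_left (h : IsHermitianSchmidt A lam γ δ) (i j : Fin n) :
    (γ i * γ j).trace = if i = j then 1 else 0 := by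
  rw [← h.orthonormal_left, (h.herm_left j).eq]

theorem IsHermitianSchmidt.trace_right (h : IsHermitianSchmidt A lam γ δ) (i j : Fin n) :
    (δ i * δ j).trace = if i = j then 1 else 0 :=
  h.swap.trace_left i j

theorem IsHermitianSchmidt.lmap_apply (h : IsHermitianSchmidt A lam γ δ) (X : CMat k) :
    lmap A X = ∑ i, ((lam i : ℂ) * (γ i * X).trace) • δ i := by
  conv_lhs => rw [h.eq_sum, lmap_sum_smul_kronecker]

theorem IsHermitianSchmidt.rmap_apply (h : IsHermitianSchmidt A lam γ δ) (Y : CMat m) :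
    rmap A Y = ∑ i, ((lam i : ℂ) * (δ i * Y).trace) • γ i :=
  h.swap.lmap_apply Y

theorem IsHermitianSchmidt.lmap_left (h : IsHermitianSchmidt A lam γ δ) (j : Fin n) :
    lmap A (γ j) = (lam j : ℂ) • δ j := by
  simp [h.lmap_apply, h.trace_left]

theorem IsHermitianSchmidt.rmap_right (h : IsHermitianSchmidt A lam γ δ) (j : Fin n) :
    rmap A (δ j) = (lam j : ℂ) • γ j :=
  h.swap.lmap_left j

theorem IsHermitianSchmidt.rmap_lmap (h : IsHermitianSchmidt A lam γ δ) (X : CMat k) :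
    rmap A (lmap A X) = ∑ i, ((lam i : ℂ) ^ 2 * (γ i * X).trace) • γ i := by
  rw [h.lmap_apply, map_sum]
  refine Finset.sum_congr rfl fun i _ => ?_
  rw [map_smul, h.rmap_right, smul_smul]
  congr 1
  ring

theorem IsHermitianSchmidt.left_ne_zero (h : IsHermitianSchmidt A lam γ δ) (j : Fin n) :
    γ j ≠ 0 := fun h0 => by
  have := h.trace_left j j
  simp [h0] at this

theorem IsHermitianSchmidt.right_ne_zero (h : IsHermitianSchmidt A lam γ δ) (j : Fin n) :
    δ j ≠ 0 := h.swap.left_ne_zero j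

theorem IsHermitianSchmidt.trace_mul_sum_left (h : IsHermitianSchmidt A lam γ δ)
    (c : Fin n → ℂ) (j : Fin n) : (γ j * ∑ i, c i • γ i).trace = c j := by
  simp [Finset.mul_sum, trace_sum, h.trace_left]

end Schmidt

/-! ### One split decomposition: sum formula and weak irreducibility of the pieces -/

section SplitData

open Matrix

variable {k m n s : ℕ} {A : BiMat k m} {lam : Fin n → ℝ} {γ : Fin n → CMat k}
  {δ : Fin n → CMat m} {γ' : Fin s → CMat k} {δ' : Fin s → CMat m}

theorem IsSplitData.swap (h : IsSplitData A lam γ δ γ' δ') :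
    IsSplitData (A.submatrix Prod.swap Prod.swap) lam δ γ δ' γ' where
  schmidt := h.schmidt.swap
  antitone := h.antitone
  one_le := h.one_le
  le := h.le
  top_eq := h.top_eq
  top_gt := h.top_gt
  schmidt_top := by
    convert h.schmidt_top.swap using 1
    ext p q
    simp [Matrix.sum_apply, Matrix.kroneckerMap_apply, mul_comm]
  posSemidef_left := h.posSemidef_right
  posSemidef_right := h.posSemidef_left

theorem sum_top_kronecker (s : ℕ) (γ : Fin n → CMat k) (δ : Fin n → CMat m) :
    ∑ i ∈ Finset.univ.filter (fun i : Fin n => (i : ℕ) < s), γ i ⊗ₖ δ i =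
      ∑ i : Fin n, (((if (i : ℕ) < s then 1 else 0 : ℝ)) : ℂ) • (γ i ⊗ₖ δ i) := by
  rw [Finset.sum_filter]
  refine Finset.sum_congr rfl fun i _ => ?_
  split_ifs <;> simp

theorem IsSplitData.top_left (h : IsSplitData A lam γ δ γ' δ') (j : Fin s) :
    γ' j = ∑ i : Fin n, ((if (i : ℕ) < s then 1 else 0 : ℝ) * (δ i * δ' j).trace : ℂ) • γ i := by
  have h1 := h.schmidt_top.rmap_right j
  rw [sum_top_kronecker, rmap_sum_smul_kronecker] at h1
  simpa using h1.symm

theorem IsSplitData.top_right (h : IsSplitData A lam γ δ γ' δ') (j : Fin s) :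
    δ' j = ∑ i : Fin n, ((if (i : ℕ) < s then 1 else 0 : ℝ) * (γ i * γ' j).trace : ℂ) • δ i :=
  h.swap.top_left j

/-- The largest Schmidt coefficient. -/
theorem IsSplitData.exists_top (h : IsSplitData A lam γ δ γ' δ') :
    ∃ l : ℝ, 0 < l ∧ (∀ i : Fin n, (i : ℕ) < s → lam i = l) ∧
      ∀ i : Fin n, s ≤ (i : ℕ) → lam i < l := by
  have h0 := h.one_le
  have hs := h.le
  refine ⟨lam ⟨0, by omega⟩, h.schmidt.pos _, fun i hi => h.top_eq _ _ hi h0,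
    fun i hi => h.top_gt _ _ h0 hi⟩

/-- Each `γ' j` lies in the span of the top `γ i`, where `lmap A` is `l` times the map of the top
part, and the latter sends `γ' j` to `δ' j`. -/
theorem IsSplitData.lmap_top (h : IsSplitData A lam γ δ γ' δ') {l : ℝ}
    (hl : ∀ i : Fin n, (i : ℕ) < s → lam i = l) (j : Fin s) :
    lmap A (γ' j) = (l : ℂ) • δ' j := by
  have h1 : ∀ i, (γ i * γ' j).trace =
      ((if (i : ℕ) < s then 1 else 0 : ℝ) : ℂ) * (δ i * δ' j).trace := fun i => by
    conv_lhs => rw [h.top_left j, h.schmidt.trace_mul_sum_left]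
  conv_rhs => rw [h.top_right j]
  rw [h.schmidt.lmap_apply, Finset.smul_sum]
  refine Finset.sum_congr rfl fun i _ => ?_
  rw [smul_smul, h1]
  congr 1
  split_ifs with hi
  · simp [hl i hi]
  · simp

theorem IsSplitData.rmap_top (h : IsSplitData A lam γ δ γ' δ') {l : ℝ}
    (hl : ∀ i : Fin n, (i : ℕ) < s → lam i = l) (j : Fin s) :
    rmap A (δ' j) = (l : ℂ) • γ' j :=
  h.swap.lmap_top hl j

/-- The eigenspace of the largest Schmidt coefficient, in terms of a Schmidt decomposition. -/
theorem IsHermitianSchmidt.eq_sum_top {A : BiMat k m} (h : IsHermitianSchmidt A lam γ δ)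
    {l : ℝ} (hl0 : 0 < l) (hl : ∀ i : Fin n, (i : ℕ) < s → lam i = l)
    (hl' : ∀ i : Fin n, s ≤ (i : ℕ) → lam i < l) {X : CMat k}
    (hX : rmap A (lmap A X) = (l : ℂ) ^ 2 • X) :
    X = ∑ i : Fin n, ((if (i : ℕ) < s then 1 else 0 : ℝ) * (γ i * X).trace : ℂ) • γ i := by
  rw [h.rmap_lmap] at hX
  have hl2 : (l : ℂ) ^ 2 ≠ 0 := pow_ne_zero _ (by exact_mod_cast hl0.ne')
  have hx : ∀ i : Fin n, s ≤ (i : ℕ) → (γ i * X).trace = 0 := fun i hi => by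
    have h1 := congrArg (fun M => (γ i * M).trace) hX
    simp only [h.trace_mul_sum_left, mul_smul_comm, trace_smul, smul_eq_mul] at h1
    have h2 : (lam i : ℂ) ^ 2 ≠ (l : ℂ) ^ 2 := by
      exact_mod_cast (pow_lt_pow_left₀ (hl' i hi) (h.pos i).le two_ne_zero).ne
    by_contra h3
    exact h2 (mul_right_cancel₀ h3 h1)
  refine smul_right_injective _ hl2 ?_
  simp only
  rw [← hX, Finset.smul_sum]
  refine Finset.sum_congr rfl fun i _ => ?_
  rw [smul_smul]
  congr 1
  split_ifs with hi
  · simp [hl i hi]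
  · simp [hx i (not_lt.mp hi)]

/-- For the top part `D`, the map `rmap D ∘ lmap D` is the orthogonal projection onto the top space.
Its two Schmidt decompositions express it through the `γ i` and through the `γ' j`. -/
theorem IsSplitData.eq_sum_top (h : IsSplitData A lam γ δ γ' δ') {l : ℝ} (hl0 : 0 < l)
    (hl : ∀ i : Fin n, (i : ℕ) < s → lam i = l) (hl' : ∀ i : Fin n, s ≤ (i : ℕ) → lam i < l)
    {X : CMat k} (hX : rmap A (lmap A X) = (l : ℂ) ^ 2 • X) :
    X = ∑ j, (γ' j * X).trace • γ' j := by
  have h1 := h.schmidt.eq_sum_top hl0 hl hl' hX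
  have h2 := h.schmidt_top.rmap_lmap X
  simp only [Complex.ofReal_one, one_pow, one_mul] at h2
  rw [← h2, sum_top_kronecker, lmap_sum_smul_kronecker, map_sum]
  conv_lhs => rw [h1]
  refine Finset.sum_congr rfl fun i _ => ?_
  rw [map_smul, rmap_sum_smul_kronecker, Finset.sum_eq_single i]
  · rw [smul_smul, h.schmidt.trace_right, if_pos rfl]
    split_ifs <;> simp
  · intro j _ hj
    rw [h.schmidt.trace_right, if_neg hj]
    simp
  · simp

theorem IsSplitData.mul_eq_zero_left (h : IsSplitData A lam γ δ γ' δ') {i j : Fin s}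
    (hij : i ≠ j) : γ' i * γ' j = 0 :=
  mul_eq_zero_of_trace_mul_eq_zero (h.posSemidef_left i) (h.posSemidef_left j) (by
    rw [h.schmidt_top.trace_left, if_neg hij])

theorem IsSplitData.complProj_add_sum (h : IsSplitData A lam γ δ γ' δ') :
    complProj γ' + ∑ i, supp (γ' i) = 1 :=
  complProj_add_sum_supp h.schmidt_top.herm_left fun _ _ => h.mul_eq_zero_left

theorem IsSplitData.supp_mul_supp_left (h : IsSplitData A lam γ δ γ' δ') {i j : Fin s}
    (hij : i ≠ j) : supp (γ' i) * supp (γ' j) = 0 :=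
  supp_mul_eq_zero (h.schmidt_top.herm_left i) (mul_supp_eq_zero (h.mul_eq_zero_left hij))

theorem IsSplitData.supp_mul_complProj_left (h : IsSplitData A lam γ δ γ' δ') (i : Fin s) :
    supp (γ' i) * complProj γ' = 0 := by
  have h1 := congrArg (supp (γ' i) * ·) h.complProj_add_sum
  simp only [mul_add, Finset.mul_sum, mul_one] at h1
  rw [Finset.sum_eq_single i (fun j _ hj => h.supp_mul_supp_left hj.symm) (by simp),
    (isIdempotentElem_supp _).eq] at h1
  simpa using h1

theorem SplitsAlong.mul_kronecker_eq_compress {A : BiMat k m} {V : CMat k} {W : CMat m}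
    (h : SplitsAlong A V W) (hV : IsIdempotentElem V) (hW : IsIdempotentElem W) :
    A * (V ⊗ₖ W) = compress V W A := by
  conv_lhs => rw [h]
  unfold compress
  rw [add_mul, Matrix.mul_assoc _ (V ⊗ₖ W), ← mul_kronecker_mul, hV.eq, hW.eq,
    Matrix.mul_assoc _ ((1 - V) ⊗ₖ (1 - W)), ← mul_kronecker_mul, sub_mul, one_mul, hV.eq, sub_self,
    zero_kronecker, Matrix.mul_zero, add_zero]

/-- Multiply `A` by the resolution of the identity in the left factor. Each `supp (γ' i) ⊗ 1` leaves
only the matching diagonal block, and `complProj γ' ⊗ 1` only the block with `complProj δ'`, as all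
mixed blocks are killed by `A`. -/
theorem IsSplitData.sum_eq (h : IsSplitData A lam γ δ γ' δ') (hA : A.PosSemidef)
    (hsp : ∀ i, SplitsAlong A (supp (γ' i)) (supp (δ' i))) :
    A * (complProj γ' ⊗ₖ complProj δ') = splitRemainder A γ' δ' ∧
      A = ∑ i, splitPiece A γ' δ' i + splitRemainder A γ' δ' := by
  obtain ⟨l, hl0, hl, hl'⟩ := h.exists_top
  set V := complProj γ' with hV
  set W := complProj δ' with hW
  have hp : ∀ i, A * (supp (γ' i) ⊗ₖ supp (δ' i)) = splitPiece A γ' δ' i := fun i =>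
    (hsp i).mul_kronecker_eq_compress (isIdempotentElem_supp _) (isIdempotentElem_supp _)
  have h1 : ∀ i, A * (supp (γ' i) ⊗ₖ 1) = splitPiece A γ' δ' i := fun i => by
    have h0 := mul_supp_kronecker_eq_zero hA (h.posSemidef_left i) (h.lmap_top hl i)
    rw [← hp, ← sub_add_cancel 1 (supp (δ' i)), kronecker_add, mul_add, h0, zero_add]
  have h2 : ∀ i, A * (V ⊗ₖ supp (δ' i)) = 0 := fun i => by
    have h0 := mul_kronecker_supp_eq_zero hA (h.posSemidef_right i) (h.rmap_top hl i)
    have h3 : V = (1 - supp (γ' i)) * V := by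
      rw [sub_mul, one_mul, h.supp_mul_complProj_left, sub_zero]
    rw [h3, ← mul_one (supp (δ' i)), mul_kronecker_mul, ← Matrix.mul_assoc, h0, Matrix.zero_mul]
  have h3 : A * (V ⊗ₖ W) = A * (V ⊗ₖ 1) := by
    have h4 : A * (V ⊗ₖ ∑ i, supp (δ' i)) = 0 := by
      have : V ⊗ₖ (∑ i, supp (δ' i)) = ∑ i, V ⊗ₖ supp (δ' i) := by
        ext p q
        simp [kroneckerMap_apply, Matrix.sum_apply, Finset.mul_sum]
      rw [this, Finset.mul_sum]
      exact Finset.sum_eq_zero fun i _ => h2 i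
    rw [← h.swap.complProj_add_sum, kronecker_add, mul_add, h4, add_zero]
  have h5 : A = ∑ i, splitPiece A γ' δ' i + A * (V ⊗ₖ W) := by
    have : (∑ i, supp (γ' i)) ⊗ₖ (1 : CMat m) = ∑ i, supp (γ' i) ⊗ₖ 1 := by
      ext p q
      simp only [kroneckerMap_apply, Matrix.sum_apply, Finset.sum_mul]
    rw [h3, ← Finset.sum_congr rfl fun i _ => h1 i, ← Finset.mul_sum, ← this, ← mul_add,
      ← add_kronecker, add_comm _ V, h.complProj_add_sum, one_kronecker_one, mul_one]
  have hQ : (V ⊗ₖ W)ᴴ = V ⊗ₖ W := by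
    rw [conjTranspose_kronecker, show Vᴴ = V from (isStarProjection_complProj γ').2,
      show Wᴴ = W from (isStarProjection_complProj δ').2]
  have hVV : ∀ i, V * supp (γ' i) = 0 := fun i => mul_comm_eq_zero (isHermitian_supp _)
    (isStarProjection_complProj γ').2 (h.supp_mul_complProj_left i)
  have h6 : (V ⊗ₖ W) * A = (V ⊗ₖ W) * A * (V ⊗ₖ W) := by
    conv_lhs => rw [h5, mul_add, Finset.mul_sum]
    rw [Finset.sum_eq_zero, zero_add, Matrix.mul_assoc]
    intro i _
    change _ * compress (supp (γ' i)) (supp (δ' i)) A = 0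
    rw [compress, ← Matrix.mul_assoc, ← Matrix.mul_assoc, ← mul_kronecker_mul, hVV]
    simp
  have h7 : A * (V ⊗ₖ W) = splitRemainder A γ' δ' := by
    have h8 := congrArg conjTranspose h6
    rw [conjTranspose_mul, conjTranspose_mul, conjTranspose_mul, hQ, hA.1.eq] at h8
    rw [h8, splitRemainder, compress, Matrix.mul_assoc]
  exact ⟨h7, by rw [← h7]; exact h5⟩

theorem IsSplitData.lmap_splitPiece (h : IsSplitData A lam γ δ γ' δ') {l : ℝ}
    (hl : ∀ i : Fin n, (i : ℕ) < s → lam i = l) (i : Fin s) :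
    lmap (splitPiece A γ' δ' i) (γ' i) = (l : ℂ) • δ' i := by
  change lmap (compress (supp (γ' i)) (supp (δ' i)) A) (γ' i) = _
  rw [lmap_compress, supp_mul, mul_supp (h.schmidt_top.herm_left i), h.lmap_top hl,
    mul_smul_comm, smul_mul_assoc, supp_mul, mul_supp (h.schmidt_top.herm_right i)]

theorem submatrix_swap_compress (V : CMat k) (W : CMat m) (A : BiMat k m) :
    (compress V W A).submatrix Prod.swap Prod.swap =
      compress W V (A.submatrix Prod.swap Prod.swap) := by
  refine lmap_injective fun Y => ?_
  rw [lmap_compress]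
  exact rmap_compress V W A Y

theorem IsSplitData.rmap_splitPiece (h : IsSplitData A lam γ δ γ' δ') {l : ℝ}
    (hl : ∀ i : Fin n, (i : ℕ) < s → lam i = l) (i : Fin s) :
    rmap (splitPiece A γ' δ' i) (δ' i) = (l : ℂ) • γ' i := by
  have h1 := h.swap.lmap_splitPiece hl i
  rwa [splitPiece, ← submatrix_swap_compress] at h1

theorem IsSplitData.splitPiece_ne_zero (h : IsSplitData A lam γ δ γ' δ') (i : Fin s) :
    splitPiece A γ' δ' i ≠ 0 := fun h0 => by
  obtain ⟨l, hl0, hl, hl'⟩ := h.exists_top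
  have h1 := h.lmap_splitPiece hl i
  have h2 : lmap (0 : BiMat k m) (γ' i) = 0 := by ext; simp [lmap]
  rw [h0, h2] at h1
  exact (smul_ne_zero (by exact_mod_cast hl0.ne') (h.schmidt_top.right_ne_zero i)) h1.symm

theorem compress_compress_eq_zero {V V₁ : CMat k} {W W₁ : CMat m} (h : V₁ * V = 0) :
    compress V₁ W₁ (compress V W A) = 0 := by
  rw [compress, compress, Matrix.mul_assoc (V ⊗ₖ W), ← Matrix.mul_assoc (V₁ ⊗ₖ W₁),
    ← mul_kronecker_mul, h, zero_kronecker, Matrix.zero_mul, Matrix.zero_mul]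

/-- The top singular vectors of `A` supported in `supp (γ' i)` are the multiples of `γ' i`. A
splitting of the piece would compress `γ' i` to such a vector, so `γ' i` lies entirely in one block.
-/
theorem IsSplitData.isWeakIrreducible_splitPiece (h : IsSplitData A lam γ δ γ' δ')
    (hA : A.PosSemidef) (hsp : ∀ i, SplitsAlong A (supp (γ' i)) (supp (δ' i))) (i : Fin s) :
    IsWeakIrreducible (splitPiece A γ' δ' i) := by
  obtain ⟨l, hl0, hl, hl'⟩ := h.exists_top
  have hl1 : (l : ℂ) ≠ 0 := by exact_mod_cast hl0.ne'
  have hγ := h.schmidt_top.herm_left i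
  have hδ := h.schmidt_top.herm_right i
  set V := supp (γ' i) with hV
  set W := supp (δ' i) with hW
  have hB : splitPiece A γ' δ' i = compress V W A := rfl
  have hlB := h.lmap_splitPiece hl i
  have hrB := h.rmap_splitPiece hl i
  refine ⟨posSemidef_conj ?_ hA, ?_⟩
  · rw [IsHermitian, conjTranspose_kronecker]
    congr 1
    exacts [(isHermitian_supp _).eq, (isHermitian_supp _).eq]
  intro V₁ V₂ W₁ W₂ hV₁ hV₂ hW₁ hW₂ _ _ hVs hWs hdec
  obtain rfl : V₂ = 1 - V₁ := eq_sub_of_add_eq' hVs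
  obtain rfl : W₂ = 1 - W₁ := eq_sub_of_add_eq' hWs
  set B := splitPiece A γ' δ' i with hBdef
  have hS : SplitsAlong B V₁ W₁ := hdec
  have hVi : IsIdempotentElem V₁ := hV₁.1
  have hWi : IsIdempotentElem W₁ := hW₁.1
  -- The splitting makes `l • γ' i` and `l • δ' i` block diagonal, hence commuting with the
  -- projections `V₁` and `W₁`.
  have hcomm : ∀ {r : ℕ} {E P Q Z : CMat r}, IsIdempotentElem E →
      (l : ℂ) • Z = E * P * E + (1 - E) * Q * (1 - E) → E * Z * E = E * Z ∧ E * Z * E = Z * E := by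
    intro r E P Q Z hE hZ
    have e1 : E * (1 - E) = 0 := by rw [mul_sub, mul_one, hE.eq, sub_self]
    have e2 : (1 - E) * E = 0 := by rw [sub_mul, one_mul, hE.eq, sub_self]
    have e3 : E * ((l : ℂ) • Z) = E * P * E := by
      rw [hZ, mul_add, ← mul_assoc, ← mul_assoc, hE.eq, ← mul_assoc, ← mul_assoc, e1]
      simp
    have e4 : ((l : ℂ) • Z) * E = E * P * E := by
      rw [hZ, add_mul, mul_assoc _ E, hE.eq, mul_assoc _ (1 - E), e2]
      simp
    have e5 : E * Z = Z * E := smul_right_injective _ hl1 (by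
      simpa using e3.trans e4.symm)
    constructor
    · rw [mul_assoc, ← e5, ← mul_assoc, hE.eq]
    · rw [e5, mul_assoc, hE.eq]
  obtain ⟨c1, c2⟩ := hcomm hVi (hrB.symm.trans (hS.rmap_eq _))
  obtain ⟨d1, d2⟩ := hcomm hWi (hlB.symm.trans (hS.lmap_eq _))
  set X := V₁ * γ' i * V₁ with hX
  set Y := W₁ * δ' i * W₁ with hY
  have hXV : V * X * V = X := by
    rw [c2, ← mul_assoc, supp_mul, ← c2, c1, mul_assoc, mul_supp hγ]
  have hYW : W * Y * W = Y := by
    rw [d2, ← mul_assoc, supp_mul, ← d2, d1, mul_assoc, mul_supp hδ]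
  -- Since `A` splits along `V` and `W`, the maps of `A` and of the piece agree on matrices
  -- compressed by `V`; the singular relation thus passes from the piece to `A`.
  have hlX : lmap A X = (l : ℂ) • Y := by
    have e1 : lmap B X = (l : ℂ) • Y := by
      rw [hX, hS.lmap_conj hVi hWi, hlB, mul_smul_comm, smul_mul_assoc]
    rw [← e1, hB, lmap_compress, (hsp i).lmap_conj (isIdempotentElem_supp _)
      (isIdempotentElem_supp _), conj_conj (isIdempotentElem_supp _),
      ← (hsp i).lmap_conj (isIdempotentElem_supp _) (isIdempotentElem_supp _), hXV]
  have hrY : rmap A Y = (l : ℂ) • X := by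
    have e1 : rmap B Y = (l : ℂ) • X := by
      rw [hY, hS.rmap_conj hVi hWi, hrB, mul_smul_comm, smul_mul_assoc]
    rw [← e1, hB, rmap_compress, (hsp i).rmap_conj (isIdempotentElem_supp _)
      (isIdempotentElem_supp _), conj_conj (isIdempotentElem_supp _),
      ← (hsp i).rmap_conj (isIdempotentElem_supp _) (isIdempotentElem_supp _), hYW]
  have hXsum := h.eq_sum_top hl0 hl hl' (X := X) (by
    rw [hlX, map_smul, hrY, smul_smul, sq])
  -- In the expansion of `X` over the `γ' j`, only `j = i` survives, because `γ' j * γ' i = 0`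
  -- otherwise and `X = γ' i * V₁`.
  obtain ⟨c, hc⟩ : ∃ c : ℂ, X = c • γ' i := by
    refine ⟨_, hXsum.trans (Finset.sum_eq_single i (fun j _ hj => ?_) (by simp))⟩
    rw [c2, ← mul_assoc, h.mul_eq_zero_left hj, zero_mul, trace_zero, zero_smul]
  -- `X = V₁ * γ' i` is fixed by left multiplication by `V₁`, so `V₁` acts on `γ' i` as an
  -- idempotent scalar.
  have hc2 : c * c = c := by
    have e1 : V₁ * X = X := by rw [hX, ← mul_assoc, ← mul_assoc, hVi.eq]
    rw [hc, mul_smul_comm, ← c1, hc, smul_smul] at e1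
    exact smul_left_injective ℂ (h.schmidt_top.left_ne_zero i) e1
  have hc3 : c = 0 ∨ c = 1 := by
    rcases eq_or_ne c 0 with h0 | h0
    · exact Or.inl h0
    · exact Or.inr ((mul_eq_left₀ h0).mp hc2)
  rcases hc3 with rfl | rfl
  · left
    refine compress_compress_eq_zero (mul_supp_eq_zero ?_)
    rw [← c1, hc, zero_smul]
  · right
    refine compress_compress_eq_zero (mul_supp_eq_zero ?_)
    rw [sub_mul, one_mul, ← c1, hc, one_smul, sub_self]

end SplitData

/-! ### Existence of Hermitian Schmidt decompositions by the spectral theorem -/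

section HermMat

open Matrix

/-- The real vector space of Hermitian matrices. -/
def HermMat (k : ℕ) : Type := selfAdjoint (CMat k)

instance (k : ℕ) : AddCommGroup (HermMat k) := inferInstanceAs (AddCommGroup (selfAdjoint (CMat k)))

noncomputable instance (k : ℕ) : Module ℝ (HermMat k) :=
  inferInstanceAs (Module ℝ (selfAdjoint (CMat k)))

instance (k : ℕ) : FiniteDimensional ℝ (HermMat k) :=
  inferInstanceAs (FiniteDimensional ℝ (selfAdjoint.submodule ℝ (CMat k)))

namespace HermMat

variable {k m : ℕ}

/-- The matrix underlying an element of `HermMat k`, as an `ℝ`-linear map. -/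
def val : HermMat k →ₗ[ℝ] CMat k where
  toFun X := Subtype.val X
  map_add' _ _ := rfl
  map_smul' _ _ := rfl

theorem isHermitian_val (X : HermMat k) : (val X).IsHermitian := X.2

theorem val_injective : Function.Injective (val : HermMat k → CMat k) := Subtype.val_injective

/-- A Hermitian matrix as an element of `HermMat k`. -/
def mk (X : CMat k) (hX : X.IsHermitian) : HermMat k := ⟨X, hX⟩

theorem val_mk (X : CMat k) (hX : X.IsHermitian) : val (mk X hX) = X := rfl

/-- The inner product `tr (X Y)` of Hermitian matrices. -/
@[reducible]
noncomputable def innerCore (k : ℕ) : InnerProductSpace.Core ℝ (HermMat k) where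
  inner X Y := (val X * val Y).trace.re
  conj_inner_symm X Y := by
    change (val Y * val X).trace.re = _
    rw [trace_mul_comm]
  re_inner_nonneg X := (Complex.nonneg_iff.mp (trace_mul_self_nonneg (isHermitian_val X))).1
  add_left X Y Z := by
    rw [map_add, add_mul, trace_add, Complex.add_re]
  smul_left X Y r := by
    change ((val (r • X)) * val Y).trace.re = r * (val X * val Y).trace.re
    rw [map_smul, smul_mul_assoc, trace_smul, Complex.smul_re, smul_eq_mul]
  definite X hX := by
    refine val_injective ?_
    rw [map_zero, ← trace_mul_self_eq_zero_iff (isHermitian_val X)]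
    exact Complex.ext hX (im_trace_mul_eq_zero (isHermitian_val X) (isHermitian_val X))

noncomputable instance (k : ℕ) : NormedAddCommGroup (HermMat k) :=
  (innerCore k).toNormedAddCommGroup

noncomputable instance (k : ℕ) : InnerProductSpace ℝ (HermMat k) :=
  InnerProductSpace.ofCore (innerCore k).toCore

theorem ofReal_inner (X Y : HermMat k) : ((inner ℝ X Y : ℝ) : ℂ) = (val X * val Y).trace :=
  Complex.ext rfl (im_trace_mul_eq_zero (isHermitian_val X) (isHermitian_val Y)).symm

theorem val_sum_smul {ι : Type*} (s : Finset ι) (c : ι → ℝ) (X : ι → HermMat k) :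
    val (∑ i ∈ s, c i • X i) = ∑ i ∈ s, (c i : ℂ) • val (X i) := by
  rw [map_sum]
  exact Finset.sum_congr rfl fun i _ => by rw [map_smul]; rfl

/-- The restriction of `lmap A` to Hermitian matrices. -/
noncomputable def lmapHerm (A : BiMat k m) (hA : A.IsHermitian) : HermMat k →ₗ[ℝ] HermMat m where
  toFun X := mk (lmap A (val X)) (isHermitian_lmap hA (isHermitian_val X))
  map_add' X Y := val_injective (by simp only [map_add, val_mk])
  map_smul' c X := val_injective (by
    simp only [map_smul, val_mk, RingHom.id_apply]
    exact (lmap A).map_smul_of_tower c _)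

theorem val_lmapHerm (A : BiMat k m) (hA : A.IsHermitian) (X : HermMat k) :
    val (lmapHerm A hA X) = lmap A (val X) := rfl

theorem lmap_ext {A B : BiMat k m} (h : ∀ X : CMat k, X.IsHermitian → lmap A X = lmap B X) :
    A = B := by
  refine lmap_injective fun X => ?_
  have hX : X = (realPart X : CMat k) + Complex.I • (imaginaryPart X : CMat k) :=
    (realPart_add_I_smul_imaginaryPart X).symm
  rw [hX, map_add, map_add, map_smul, map_smul, h _ (realPart X).2, h _ (imaginaryPart X).2]

/-- Both sides induce the same map on Hermitian `X`, by expanding `X` in the basis. The coefficient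
`1` is kept to match the shape of `lmap_sum_smul_kronecker`. -/
theorem eq_sum_kronecker_lmap {A : BiMat k m} {N : ℕ}
    (e : OrthonormalBasis (Fin N) ℝ (HermMat k)) :
    A = ∑ i, ((1 : ℝ) : ℂ) • (val (e i) ⊗ₖ lmap A (val (e i))) := by
  refine lmap_ext fun X hX => ?_
  rw [lmap_sum_smul_kronecker]
  have h := congrArg val (e.sum_repr' (mk X hX))
  rw [val_sum_smul, val_mk] at h
  conv_lhs => rw [← h, map_sum]
  refine Finset.sum_congr rfl fun i _ => ?_
  rw [map_smul, ofReal_inner, val_mk]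
  simp

/-- Used for decreasing coefficients, both to discard the zero ones and to count the multiplicity
`s` of the largest one. -/
theorem exists_initial_segment {N : ℕ} (p : Fin N → Prop) (hp : ∀ i j, i ≤ j → p j → p i) :
    ∃ n ≤ N, ∀ i : Fin N, p i ↔ (i : ℕ) < n := by
  induction N with
  | zero => exact ⟨0, le_rfl, fun i => i.elim0⟩
  | succ N ih =>
    by_cases h : p (Fin.last N)
    · exact ⟨N + 1, le_rfl, fun i => ⟨fun _ => i.2, fun _ => hp _ _ (Fin.le_last i) h⟩⟩
    · obtain ⟨n, hn, hi⟩ := ih (fun i => p i.castSucc) fun i j hij => hp _ _ (by simpa using hij)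
      refine ⟨n, by omega, fun i => ?_⟩
      induction i using Fin.lastCases with
      | last => simp [h, hn]
      | cast i => simpa using hi i

theorem exists_isHermitianSchmidt_of_basis {A : BiMat k m} {N : ℕ}
    (e : OrthonormalBasis (Fin N) ℝ (HermMat k)) (σ : Fin N → ℝ) (hσ : Antitone σ)
    (hσ0 : ∀ i, 0 ≤ σ i) (f : Fin N → HermMat m)
    (hf : ∀ i, lmap A (val (e i)) = (σ i : ℂ) • val (f i))
    (hff : ∀ i j, 0 < σ i → 0 < σ j → inner ℝ (f i) (f j) = if i = j then (1 : ℝ) else 0) :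
    ∃ (n : ℕ) (ι : Fin n → Fin N), Antitone (σ ∘ ι) ∧
      IsHermitianSchmidt A (σ ∘ ι) (fun i => val (e (ι i))) (fun i => val (f (ι i))) := by
  obtain ⟨n, hn, hi⟩ := exists_initial_segment (fun i => 0 < σ i)
    fun i j hij hj => hj.trans_le (hσ hij)
  have hpos : ∀ i : Fin n, 0 < σ (Fin.castLE hn i) := fun i => (hi _).mpr i.2
  refine ⟨n, Fin.castLE hn, fun i j hij => hσ (by simpa using hij), hpos,
    fun i => isHermitian_val _, fun i => isHermitian_val _, fun i j => ?_, fun i j => ?_, ?_⟩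
  · rw [(isHermitian_val _).eq, ← ofReal_inner, orthonormal_iff_ite.mp e.orthonormal]
    simp only [Fin.castLE_inj]
    split_ifs <;> simp
  · rw [(isHermitian_val _).eq, ← ofReal_inner, hff _ _ (hpos i) (hpos j)]
    simp only [Fin.castLE_inj]
    split_ifs <;> simp
  · conv_lhs => rw [eq_sum_kronecker_lmap (A := A) e]
    have h0 : ∀ i : Fin N, i ∉ Set.range (Fin.castLE hn) → σ i = 0 := fun i hir => by
      refine le_antisymm (not_lt.mp fun h => hir ⟨⟨i, (hi i).mp h⟩, rfl⟩) (hσ0 i)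
    symm
    refine Finset.sum_of_injOn (Fin.castLE hn) (fun i _ j _ h => by simpa using h) (by simp)
      (fun i _ hir => ?_) (fun i _ => ?_)
    · rw [hf, h0 i (by simpa using hir)]
      simp
    · rw [hf, kronecker_smul]
      simp

/-- Singular value decomposition of `G = lmapHerm A hA`: diagonalise `G* G` and normalise the images
of its eigenvectors. -/
theorem exists_isHermitianSchmidt {A : BiMat k m} (hA : A.IsHermitian) :
    ∃ (n : ℕ) (lam : Fin n → ℝ) (γ : Fin n → CMat k) (δ : Fin n → CMat m), Antitone lam ∧
      IsHermitianSchmidt A lam γ δ := by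
  set G := lmapHerm A hA with hG
  have hT := G.isSymmetric_adjoint_comp_self
  have hTp := G.isPositive_adjoint_comp_self
  set e := hT.eigenvectorBasis rfl with he
  set μ := hT.eigenvalues rfl with hμ
  have hμ0 : ∀ i, 0 ≤ μ i := fun i => hTp.nonneg_eigenvalues rfl i
  have hGG : ∀ i j, inner ℝ (G (e i)) (G (e j)) = μ i * if i = j then (1 : ℝ) else 0 := by
    intro i j
    rw [← LinearMap.adjoint_inner_left, ← LinearMap.comp_apply, hT.apply_eigenvectorBasis,
      inner_smul_left, orthonormal_iff_ite.mp e.orthonormal]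
    simp [hμ]
  -- For `μ i = 0` the inverse is `0` by convention, and the formula still holds because `G (e i) =
  -- 0`.
  have hf : ∀ i, lmap A (val (e i)) = (√(μ i) : ℂ) • val ((√(μ i))⁻¹ • G (e i)) := by
    intro i
    rw [← val_lmapHerm A hA, ← hG]
    change _ = √(μ i) • val ((√(μ i))⁻¹ • G (e i))
    rw [← map_smul, smul_smul]
    rcases eq_or_ne (√(μ i)) 0 with h0 | h0
    · have h3 : G (e i) = 0 := by
        rw [← inner_self_eq_zero (𝕜 := ℝ), hGG, (Real.sqrt_eq_zero (hμ0 i)).mp h0, zero_mul]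
      rw [h3, smul_zero, map_zero]
    · rw [mul_inv_cancel₀ h0, one_smul]
  have hff : ∀ i j, 0 < √(μ i) → 0 < √(μ j) →
      inner ℝ ((√(μ i))⁻¹ • G (e i)) ((√(μ j))⁻¹ • G (e j)) = if i = j then (1 : ℝ) else 0 := by
    intro i j hi hj
    rw [inner_smul_left, inner_smul_right, hGG]
    split_ifs with hij
    · subst hij
      simp only [conj_trivial, mul_one]
      rw [← mul_assoc, ← mul_inv, Real.mul_self_sqrt (hμ0 i), inv_mul_cancel₀]
      exact fun h0 => by simp [h0] at hi
    · simp
  obtain ⟨n, ι, h1, h2⟩ := exists_isHermitianSchmidt_of_basis (A := A) e (fun i => √(μ i))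
    (fun i j hij => Real.sqrt_le_sqrt (hT.eigenvalues_antitone rfl hij))
    (fun i => Real.sqrt_nonneg _) (fun i => (√(μ i))⁻¹ • G (e i)) hf hff
  exact ⟨n, _, _, _, h1, h2⟩

/-- The induced operator on Hermitian matrices is symmetric with quadratic form `∑ i, c i * ⟨C i, X⟩
^ 2 ≥ 0`, so its eigenbasis serves in both factors. No orthonormality of the `C i` is needed, which
is what compressions of SPC matrices require. -/
theorem exists_isHermitianSchmidt_symm {r : ℕ} (c : Fin r → ℝ) (hc : ∀ i, 0 ≤ c i)
    (C : Fin r → CMat k) (hC : ∀ i, (C i).IsHermitian) :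
    ∃ (n : ℕ) (lam : Fin n → ℝ) (γ : Fin n → CMat k), Antitone lam ∧
      IsHermitianSchmidt (∑ i, (c i : ℂ) • (C i ⊗ₖ C i)) lam γ γ := by
  set A := ∑ i, (c i : ℂ) • (C i ⊗ₖ C i) with hAdef
  have hA : A.IsHermitian := by
    rw [IsHermitian, hAdef, conjTranspose_sum]
    refine Finset.sum_congr rfl fun i _ => ?_
    rw [conjTranspose_smul, conjTranspose_kronecker, (hC i).eq]
    simp
  set G := lmapHerm A hA with hG
  have hin : ∀ X Y, inner ℝ (G X) Y =
      ∑ i, c i * (inner ℝ (mk (C i) (hC i)) X * inner ℝ (mk (C i) (hC i)) Y : ℝ) := by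
    intro X Y
    apply Complex.ofReal_injective
    push_cast
    simp only [ofReal_inner, val_mk]
    rw [hG, val_lmapHerm, hAdef, lmap_sum_smul_kronecker, Finset.sum_mul, trace_sum]
    refine Finset.sum_congr rfl fun i _ => ?_
    rw [smul_mul_assoc, trace_smul, smul_eq_mul, mul_assoc]
  have hT : G.IsSymmetric := fun X Y => by
    rw [hin, real_inner_comm, hin]
    exact Finset.sum_congr rfl fun i _ => by ring
  set e := hT.eigenvectorBasis rfl with he
  set μ := hT.eigenvalues rfl with hμ
  have hGe : ∀ i, G (e i) = μ i • e i := fun i => hT.apply_eigenvectorBasis rfl i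
  have hμ0 : ∀ i, 0 ≤ μ i := fun i => by
    have h1 := hin (e i) (e i)
    rw [hGe, inner_smul_left, orthonormal_iff_ite.mp e.orthonormal] at h1
    simp only [conj_trivial, if_true, mul_one] at h1
    rw [h1]
    exact Finset.sum_nonneg fun j _ => mul_nonneg (hc j) (mul_self_nonneg _)
  have he' : ∀ i, lmap A (val (e i)) = (μ i : ℂ) • val (e i) := fun i => by
    rw [← val_lmapHerm A hA, ← hG, hGe, map_smul]
    rfl
  obtain ⟨n, ι, h1, h2⟩ := exists_isHermitianSchmidt_of_basis (A := A) e μ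
    (hT.eigenvalues_antitone rfl) hμ0 e he'
    (fun i j _ _ => orthonormal_iff_ite.mp e.orthonormal i j)
  exact ⟨n, _, _, h1, h2⟩

end HermMat

theorem IsSPC.exists_antitone {k : ℕ} {A : BiMat k k} (hA : IsSPC A) :
    ∃ (n : ℕ) (lam : Fin n → ℝ) (γ : Fin n → CMat k), Antitone lam ∧
      IsHermitianSchmidt A lam γ γ := by
  obtain ⟨_, n, lam, γ, h⟩ := hA
  rw [h.eq_sum]
  exact HermMat.exists_isHermitianSchmidt_symm lam (fun i => (h.pos i).le) γ h.herm_left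

theorem IsSPC.compress {k : ℕ} {A : BiMat k k} (hA : IsSPC A) {V : CMat k} (hV : V.IsHermitian) :
    IsSPC (compress V V A) := by
  obtain ⟨hpsd, n, lam, γ, h⟩ := hA
  refine ⟨posSemidef_conj ?_ hpsd, ?_⟩
  · rw [IsHermitian, conjTranspose_kronecker, hV.eq]
  · have h1 : _root_.compress V V A =
        ∑ i, (lam i : ℂ) • ((V * γ i * V) ⊗ₖ (V * γ i * V)) := by
      conv_lhs => rw [h.eq_sum]
      rw [_root_.compress, Finset.mul_sum, Finset.sum_mul]
      refine Finset.sum_congr rfl fun i _ => ?_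
      rw [mul_smul_comm, smul_mul_assoc, mul_kronecker_mul, mul_kronecker_mul]
    obtain ⟨r, mu, C, -, hC⟩ := HermMat.exists_isHermitianSchmidt_symm lam
      (fun i => (h.pos i).le) (fun i => V * γ i * V)
      (fun i => isHermitian_conj hV (h.herm_left i))
    exact ⟨r, mu, C, by rw [h1]; exact hC⟩

end HermMat

/-! ### Orthonormal positive semidefinite bases -/

section PosLattice

open Matrix

variable {k : ℕ}

/-- A real space of Hermitian matrices that contains the positive part of each of its elements and
is block diagonal along the support of each of its positive semidefinite elements. -/
structure IsPosLattice (S : Submodule ℝ (CMat k)) : Prop where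
  herm : ∀ Z ∈ S, Z.IsHermitian
  pos : ∀ Z ∈ S, ∀ P N : CMat k, P.PosSemidef → N.PosSemidef → Z = P - N → P * N = 0 → P ∈ S
  conj_mem : ∀ X ∈ S, X.PosSemidef → ∀ Z ∈ S, supp X * Z * supp X ∈ S
  block : ∀ X ∈ S, X.PosSemidef → ∀ Z ∈ S,
    Z = supp X * Z * supp X + (1 - supp X) * Z * (1 - supp X)

/-- The elements `Z` of `S` with `E * Z = 0`. -/
noncomputable def annihilated (S : Submodule ℝ (CMat k)) (E : CMat k) : Submodule ℝ (CMat k) :=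
  S ⊓ LinearMap.ker (LinearMap.mulLeft ℝ E)

theorem mem_annihilated {S : Submodule ℝ (CMat k)} {E Z : CMat k} :
    Z ∈ annihilated S E ↔ Z ∈ S ∧ E * Z = 0 := Iff.rfl

/-- If `E * Z = 0` and `Z = P - N` with `P * N = 0`, then `E * P * P = E * Z * P = 0`, whence `E * P
= 0`. This keeps the hypotheses available in the induction on dimension. -/
theorem IsPosLattice.isPosLattice_annihilated {S : Submodule ℝ (CMat k)}
    (hS : IsPosLattice S) {E : CMat k} (hE : E.IsHermitian) : IsPosLattice (annihilated S E) where
  herm Z hZ := hS.herm Z hZ.1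
  pos Z hZ P N hP hN hPN h0 := by
    refine ⟨hS.pos Z hZ.1 P N hP hN hPN h0, ?_⟩
    have h1 : E * (P * P) = 0 := by
      have h2 : Z * P = P * P := by rw [hPN, sub_mul, mul_comm_eq_zero hP.1 hN.1 h0, sub_zero]
      rw [← h2, ← mul_assoc, (mem_annihilated.mp hZ).2, zero_mul]
    change E * P = 0
    rw [← self_mul_conjTranspose_eq_zero, conjTranspose_mul, hE.eq, hP.1.eq, Matrix.mul_assoc,
      ← Matrix.mul_assoc P, ← Matrix.mul_assoc, h1, Matrix.zero_mul]
  conj_mem X hX hXp Z hZ := by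
    refine ⟨hS.conj_mem X hX.1 hXp Z hZ.1, ?_⟩
    change E * (supp X * Z * supp X) = 0
    rw [← mul_assoc, ← mul_assoc, mul_supp_eq_zero (mem_annihilated.mp hX).2, zero_mul, zero_mul]
  block X hX hXp Z hZ := hS.block X hX.1 hXp Z hZ.1

theorem re_trace_mul_self_pos {X : CMat k} (hX : X.IsHermitian) (h0 : X ≠ 0) :
    0 < (X * X).trace.re := by
  refine lt_of_le_of_ne (Complex.nonneg_iff.mp (trace_mul_self_nonneg hX)).1 fun h => h0 ?_
  rw [← trace_mul_self_eq_zero_iff hX]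
  exact Complex.ext h.symm (im_trace_mul_eq_zero hX hX)

theorem IsPosLattice.neg_mem {S : Submodule ℝ (CMat k)} (hS : IsPosLattice S) {Z P N : CMat k}
    (hZ : Z ∈ S) (hP : P.PosSemidef) (hN : N.PosSemidef) (hPN : Z = P - N) (h0 : P * N = 0) :
    N ∈ S := by
  have h1 := S.sub_mem (hS.pos Z hZ P N hP hN hPN h0) hZ
  rwa [hPN, sub_sub_cancel] at h1

theorem IsPosLattice.exists_posSemidef {S : Submodule ℝ (CMat k)} (hS : IsPosLattice S)
    (h : S ≠ ⊥) : ∃ X ∈ S, X.PosSemidef ∧ X ≠ 0 := by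
  obtain ⟨Z, hZ, hZ0⟩ := Submodule.exists_mem_ne_zero_of_ne_bot h
  obtain ⟨P, N, hP, hN, hPN, h0⟩ := exists_posSemidef_sub_posSemidef (hS.herm Z hZ)
  by_cases hP0 : P = 0
  · exact ⟨N, hS.neg_mem hZ hP hN hPN h0, hN, fun hN0 => hZ0 (by rw [hPN, hP0, hN0, sub_zero])⟩
  · exact ⟨P, hS.pos Z hZ P N hP hN hPN h0, hP, hP0⟩

/-- Take a nonzero element of `S` orthogonal to `X`. If both its positive and negative parts are
nonzero, they are the pair; otherwise it is positive up to sign, and trace orthogonality to `X`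
makes the product with `X` zero. -/
theorem IsPosLattice.exists_pair {S : Submodule ℝ (CMat k)} (hS : IsPosLattice S)
    {X : CMat k} (hX : X ∈ S) (hXp : X.PosSemidef) (hX0 : X ≠ 0)
    (h : ¬ S ≤ Submodule.span ℝ {X}) :
    ∃ X₁ ∈ S, ∃ X₂ ∈ S, X₁.PosSemidef ∧ X₂.PosSemidef ∧ X₁ ≠ 0 ∧ X₂ ≠ 0 ∧ X₁ * X₂ = 0 := by
  obtain ⟨Z, hZ, hZX⟩ := SetLike.not_le_iff_exists.mp h
  have hpos := re_trace_mul_self_pos hXp.1 hX0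
  set c : ℝ := (Z * X).trace.re / (X * X).trace.re with hc
  have hY : Z - c • X ∈ S := S.sub_mem hZ (S.smul_mem c hX)
  have hY0 : Z - c • X ≠ 0 := fun h0 => hZX (by
    rw [sub_eq_zero.mp h0]
    exact Submodule.smul_mem _ _ (Submodule.mem_span_singleton_self X))
  have hYX : ((Z - c • X) * X).trace = 0 := by
    refine Complex.ext ?_ (im_trace_mul_eq_zero (hS.herm _ hY) hXp.1)
    rw [sub_mul, smul_mul_assoc, trace_sub, trace_smul, Complex.sub_re, Complex.smul_re, hc,
      smul_eq_mul, div_mul_cancel₀ _ hpos.ne', sub_self, Complex.zero_re]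
  obtain ⟨P, N, hP, hN, hPN, h0⟩ := exists_posSemidef_sub_posSemidef (hS.herm _ hY)
  have hPS := hS.pos _ hY P N hP hN hPN h0
  have hNS := hS.neg_mem hY hP hN hPN h0
  by_cases hP0 : P = 0
  · subst hP0
    rw [zero_sub] at hPN
    refine ⟨N, hNS, X, hX, hN, hXp, fun hN0 => hY0 (by rw [hPN, hN0, neg_zero]), hX0, ?_⟩
    refine mul_eq_zero_of_trace_mul_eq_zero hN hXp ?_
    rwa [hPN, neg_mul, trace_neg, neg_eq_zero] at hYX
  · by_cases hN0 : N = 0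
    · subst hN0
      rw [sub_zero] at hPN
      refine ⟨P, hPS, X, hX, hP, hXp, hP0, hX0, mul_eq_zero_of_trace_mul_eq_zero hP hXp ?_⟩
      rwa [hPN] at hYX
    · exact ⟨P, hPS, N, hNS, hP, hN, hP0, hN0, h0⟩

/-- Induction on dimension. If `S` is not spanned by one positive matrix, cut it along the support
`V` of the first of two annihilating positive elements. Each element is the sum of its two diagonal
blocks, both in `S`; each block space is proper, since it misses one of the two elements. -/
theorem IsPosLattice.exists_orthonormal {S : Submodule ℝ (CMat k)} (hS : IsPosLattice S) :
    ∃ T : Finset (CMat k), (∀ X ∈ T, X ∈ S ∧ X.PosSemidef ∧ (X * X).trace = 1) ∧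
      (∀ X ∈ T, ∀ Y ∈ T, X ≠ Y → (X * Y).trace = 0) ∧ S ≤ Submodule.span ℝ T := by
  classical
  induction hd : Module.finrank ℝ S using Nat.strong_induction_on generalizing S with
  | _ d ih =>
  by_cases hbot : S = ⊥
  · exact ⟨∅, by simp, by simp, by simp [hbot]⟩
  obtain ⟨X, hX, hXp, hX0⟩ := hS.exists_posSemidef hbot
  by_cases hspan : S ≤ Submodule.span ℝ {X}
  · have hpos := re_trace_mul_self_pos hXp.1 hX0
    set c : ℝ := (√(X * X).trace.re)⁻¹ with hc
    have hc0 : 0 < c := inv_pos.mpr (Real.sqrt_pos.mpr hpos)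
    have htr : ((c • X) * (c • X)).trace = 1 := by
      have h1 : (X * X).trace = (((X * X).trace.re : ℝ) : ℂ) :=
        Complex.ext rfl (im_trace_mul_eq_zero hXp.1 hXp.1)
      have h2 : c * (c * (X * X).trace.re) = 1 := by
        rw [← mul_assoc, hc, ← mul_inv, Real.mul_self_sqrt hpos.le, inv_mul_cancel₀ hpos.ne']
      rw [smul_mul_assoc, mul_smul_comm, trace_smul, trace_smul, h1, Complex.real_smul,
        Complex.real_smul]
      exact_mod_cast h2
    refine ⟨{c • X}, fun Y hY => ?_, fun Y hY Z hZ hYZ => ?_, ?_⟩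
    · rw [Finset.mem_singleton.mp hY]
      exact ⟨S.smul_mem c hX, hXp.smul hc0.le, htr⟩
    · rw [Finset.mem_singleton.mp hY, Finset.mem_singleton.mp hZ] at hYZ
      exact absurd rfl hYZ
    · rw [Finset.coe_singleton, Submodule.span_singleton_smul_eq (hc0.ne'.isUnit)]
      exact hspan
  · obtain ⟨X₁, hX₁, X₂, hX₂, hp₁, hp₂, h₁, h₂, h12⟩ := hS.exists_pair hX hXp hX0 hspan
    set V := supp X₁ with hV
    have hVh : V.IsHermitian := isHermitian_supp X₁
    have hVX₂ : V * X₂ = 0 := supp_mul_eq_zero hp₁.1 h12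
    have hlt₁ : annihilated S (1 - V) < S := by
      refine lt_of_le_of_ne inf_le_left fun he => h₂ ?_
      have h3 := (mem_annihilated.mp (he.ge hX₂)).2
      rwa [sub_mul, one_mul, hVX₂, sub_zero] at h3
    have hlt₂ : annihilated S V < S := by
      refine lt_of_le_of_ne inf_le_left fun he => h₁ ?_
      have h3 := (mem_annihilated.mp (he.ge hX₁)).2
      rwa [hV, supp_mul] at h3
    obtain ⟨T₁, a₁, b₁, c₁⟩ := ih _ (hd ▸ Submodule.finrank_lt_finrank_of_lt hlt₁)
      (hS.isPosLattice_annihilated (isHermitian_one.sub hVh)) rfl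
    obtain ⟨T₂, a₂, b₂, c₂⟩ := ih _ (hd ▸ Submodule.finrank_lt_finrank_of_lt hlt₂)
      (hS.isPosLattice_annihilated hVh) rfl
    have hcross : ∀ Y ∈ T₁, ∀ Z ∈ T₂, (Y * Z).trace = 0 := fun Y hY Z hZ => by
      have e1 : V * Y = Y := by
        have := (mem_annihilated.mp (a₁ Y hY).1).2
        rw [sub_mul, one_mul, sub_eq_zero] at this
        exact this.symm
      have e2 : Y * V = Y := by
        simpa [conjTranspose_mul, (a₁ Y hY).2.1.1.eq, hVh.eq] using congrArg conjTranspose e1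
      rw [← e2, Matrix.mul_assoc, (mem_annihilated.mp (a₂ Z hZ).1).2, Matrix.mul_zero, trace_zero]
    refine ⟨T₁ ∪ T₂, fun Y hY => ?_, fun Y hY Z hZ hYZ => ?_, fun Z hZ => ?_⟩
    · rcases Finset.mem_union.mp hY with hY | hY
      · exact ⟨(a₁ Y hY).1.1, (a₁ Y hY).2⟩
      · exact ⟨(a₂ Y hY).1.1, (a₂ Y hY).2⟩
    · rcases Finset.mem_union.mp hY with hY | hY <;> rcases Finset.mem_union.mp hZ with hZ | hZ
      · exact b₁ Y hY Z hZ hYZ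
      · exact hcross Y hY Z hZ
      · rw [trace_mul_comm]
        exact hcross Z hZ Y hY
      · exact b₂ Y hY Z hZ hYZ
    · have hVi : V * V = V := (isIdempotentElem_supp X₁).eq
      have hm := hS.conj_mem X₁ hX₁ hp₁ Z hZ
      have hb := hS.block X₁ hX₁ hp₁ Z hZ
      have m₁ : V * Z * V ∈ annihilated S (1 - V) := by
        refine mem_annihilated.mpr ⟨hm, ?_⟩
        rw [sub_mul, one_mul, ← mul_assoc, ← mul_assoc, hVi, sub_self]
      have m₂ : (1 - V) * Z * (1 - V) ∈ annihilated S V := by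
        refine mem_annihilated.mpr ⟨?_, ?_⟩
        · rw [← add_sub_cancel_left (V * Z * V) ((1 - V) * Z * (1 - V)), ← hb]
          exact S.sub_mem hZ hm
        · rw [← mul_assoc, ← mul_assoc, show V * (1 - V) = 0 by rw [mul_sub, mul_one, hVi, sub_self],
            zero_mul, zero_mul]
      rw [hb, Finset.coe_union]
      exact Submodule.add_mem _
        (Submodule.span_mono Set.subset_union_left (c₁ m₁))
        (Submodule.span_mono Set.subset_union_right (c₂ m₂))

end PosLattice

/-! ### The top singular space and existence of split data -/

section TopEigenspace

open Matrix

variable {k m n s : ℕ} {A : BiMat k m} {lam : Fin n → ℝ} {γ : Fin n → CMat k}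
  {δ : Fin n → CMat m}

/-- The Hermitian `X` with `rmap A (lmap A X) = l ^ 2 • X`. -/
noncomputable def singularSpace (A : BiMat k m) (l : ℝ) : Submodule ℝ (CMat k) where
  carrier := {X | X.IsHermitian ∧ rmap A (lmap A X) = (l : ℂ) ^ 2 • X}
  add_mem' {X Y} hX hY := ⟨hX.1.add hY.1, by rw [map_add, map_add, hX.2, hY.2, smul_add]⟩
  zero_mem' := ⟨isHermitian_zero, by simp⟩
  smul_mem' c X hX := by
    refine ⟨?_, ?_⟩
    · rw [IsHermitian, conjTranspose_smul, hX.1.eq, star_trivial]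
    · change rmap A (lmap A ((c : ℂ) • X)) = (l : ℂ) ^ 2 • ((c : ℂ) • X)
      rw [map_smul, map_smul, hX.2, smul_comm]

theorem mem_singularSpace {l : ℝ} {X : CMat k} :
    X ∈ singularSpace A l ↔ X.IsHermitian ∧ rmap A (lmap A X) = (l : ℂ) ^ 2 • X := Iff.rfl

theorem ofReal_re_trace_mul {C X : CMat k} (hC : C.IsHermitian) (hX : X.IsHermitian) :
    (((C * X).trace.re : ℝ) : ℂ) = (C * X).trace :=
  Complex.ext rfl (im_trace_mul_eq_zero hC hX).symm

/-- The Rayleigh principle for the largest singular value. -/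
theorem IsHermitianSchmidt.mem_singularSpace_of_le (h : IsHermitianSchmidt A lam γ δ) {l : ℝ}
    (hl0 : 0 < l) (hl : ∀ i, lam i ≤ l) {M : CMat k} (hM : M.IsHermitian)
    (hle : l ^ 2 * (M * M).trace.re ≤ (lmap A M * lmap A M).trace.re) :
    M ∈ singularSpace A l := by
  set x : Fin n → ℝ := fun i => (γ i * M).trace.re with hx
  have hxc : ∀ i, (γ i * M).trace = (x i : ℂ) := fun i =>
    (ofReal_re_trace_mul (h.herm_left i) hM).symm
  -- The component of `M` orthogonal to all `γ i`, which `lmap A` kills.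
  set R : CMat k := M - ∑ i, (x i : ℂ) • γ i with hR
  have hRh : R.IsHermitian := by
    refine hM.sub ?_
    rw [IsHermitian, conjTranspose_sum]
    refine Finset.sum_congr rfl fun i _ => ?_
    rw [conjTranspose_smul, (h.herm_left i).eq]
    simp
  have hγR : ∀ i, (γ i * R).trace = 0 := fun i => by
    rw [hR, mul_sub, trace_sub, h.trace_mul_sum_left, hxc, sub_self]
  have hMR : M = R + ∑ i, (x i : ℂ) • γ i := by rw [hR, sub_add_cancel]
  have hMM : (M * M).trace = (R * R).trace + ∑ i, (x i : ℂ) ^ 2 := by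
    have e1 : (R * M).trace = (R * R).trace := by
      conv_lhs => rw [hMR]
      rw [mul_add, trace_add, Finset.mul_sum, trace_sum, Finset.sum_eq_zero, add_zero]
      intro i _
      rw [mul_smul_comm, trace_smul, trace_mul_comm, hγR, smul_zero]
    conv_lhs => enter [1, 1]; rw [hMR]
    rw [add_mul, trace_add, e1, Finset.sum_mul, trace_sum]
    congr 1
    refine Finset.sum_congr rfl fun i _ => ?_
    rw [smul_mul_assoc, trace_smul, hxc, smul_eq_mul, sq]
  have hGG : (lmap A M * lmap A M).trace = ∑ i, (lam i : ℂ) ^ 2 * (x i : ℂ) ^ 2 := by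
    rw [← trace_rmap_mul, h.rmap_lmap, Finset.sum_mul, trace_sum]
    refine Finset.sum_congr rfl fun i _ => ?_
    rw [smul_mul_assoc, trace_smul, hxc, smul_eq_mul]
    ring
  have hMM' : (M * M).trace.re = (R * R).trace.re + ∑ i, x i ^ 2 := by
    rw [hMM, Complex.add_re]
    congr 1
    rw [← Complex.ofReal_re (∑ i, x i ^ 2)]
    push_cast
    rfl
  have hGG' : (lmap A M * lmap A M).trace.re = ∑ i, lam i ^ 2 * x i ^ 2 := by
    rw [hGG]
    rw [← Complex.ofReal_re (∑ i, lam i ^ 2 * x i ^ 2)]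
    push_cast
    rfl
  have hterm : ∀ i, 0 ≤ (l ^ 2 - lam i ^ 2) * x i ^ 2 := fun i =>
    mul_nonneg (sub_nonneg.mpr (pow_le_pow_left₀ (h.pos i).le (hl i) 2)) (sq_nonneg _)
  have hRR : 0 ≤ (R * R).trace.re := (Complex.nonneg_iff.mp (trace_mul_self_nonneg hRh)).1
  -- A sum of nonnegative terms bounded by zero: hence `R = 0`, and `x i = 0` unless `lam i ^ 2 = l
  -- ^ 2`.
  have hsum : l ^ 2 * (R * R).trace.re + ∑ i, (l ^ 2 - lam i ^ 2) * x i ^ 2 ≤ 0 := by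
    rw [hMM', hGG', mul_add, Finset.mul_sum] at hle
    simp only [sub_mul, Finset.sum_sub_distrib]
    linarith
  have hs0 := Finset.sum_nonneg fun i (_ : i ∈ Finset.univ) => hterm i
  have hl2 : 0 < l ^ 2 := pow_pos hl0 2
  have hR0 : R = 0 := by
    rw [← trace_mul_self_eq_zero_iff hRh]
    refine Complex.ext ?_ (im_trace_mul_eq_zero hRh hRh)
    have e1 : l ^ 2 * (R * R).trace.re ≤ 0 := by linarith
    exact le_antisymm (by simpa using nonpos_of_mul_nonpos_right e1 hl2) hRR
  have hx0 : ∀ i, (l ^ 2 - lam i ^ 2) * x i ^ 2 = 0 := fun i =>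
    (Finset.sum_eq_zero_iff_of_nonneg fun i _ => hterm i).mp
      (le_antisymm (by nlinarith [mul_nonneg hl2.le hRR]) hs0) i (Finset.mem_univ i)
  refine mem_singularSpace.mpr ⟨hM, ?_⟩
  rw [h.rmap_lmap]
  conv_rhs => rw [hMR, hR0, zero_add, Finset.smul_sum]
  refine Finset.sum_congr rfl fun i _ => ?_
  rw [hxc, smul_smul]
  congr 1
  rcases mul_eq_zero.mp (hx0 i) with e | e
  · have : (l : ℂ) ^ 2 = (lam i : ℂ) ^ 2 := by exact_mod_cast sub_eq_zero.mp e
    rw [this]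
  · have : x i = 0 := by simpa using e
    simp [this]

/-- Positive parts come from the Rayleigh principle applied to `P + N`; the block structure comes
from the splitting of `A` along the support of a positive singular vector. -/
theorem IsHermitianSchmidt.isPosLattice (h : IsHermitianSchmidt A lam γ δ) (hA : A.PosSemidef)
    {l : ℝ} (hl0 : 0 < l) (hl : ∀ i, lam i ≤ l)
    (hsp : ∀ (X : CMat k) (Y : CMat m), X.PosSemidef → Y.PosSemidef →
      lmap A X = (l : ℂ) • Y → rmap A Y = (l : ℂ) • X → SplitsAlong A (supp X) (supp Y)) :
    IsPosLattice (singularSpace A l) := by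
  have hl1 : (l : ℂ) ≠ 0 := by exact_mod_cast hl0.ne'
  have hsp' : ∀ X ∈ singularSpace A l, X.PosSemidef → ∃ W : CMat m, IsIdempotentElem W ∧
      SplitsAlong A (supp X) W := fun X hX hXp => by
    refine ⟨supp (((l⁻¹ : ℝ) : ℂ) • lmap A X), isIdempotentElem_supp _, hsp _ _ hXp ?_ ?_ ?_⟩
    · exact (posSemidef_lmap hA hXp).smul (by exact_mod_cast (inv_pos.mpr hl0).le)
    · rw [smul_smul, Complex.ofReal_inv, mul_inv_cancel₀ hl1, one_smul]
    · rw [map_smul, (mem_singularSpace.mp hX).2, smul_smul, Complex.ofReal_inv, sq,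
        inv_mul_cancel_left₀ hl1]
  have hconj : ∀ {V : CMat k} {W : CMat m}, IsIdempotentElem V → IsIdempotentElem W →
      SplitsAlong A V W → ∀ Z ∈ singularSpace A l,
      rmap A (lmap A (V * Z * V)) = (l : ℂ) ^ 2 • (V * Z * V) := fun hV hW hS Z hZ => by
    rw [hS.lmap_conj hV hW, hS.rmap_conj hV hW, (mem_singularSpace.mp hZ).2, mul_smul_comm,
      smul_mul_assoc]
  refine ⟨fun Z hZ => hZ.1, fun Z hZ P N hP hN hPN h0 => ?_, fun X hX hXp Z hZ => ?_,
    fun X hX hXp Z hZ => ?_⟩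
  · have h0' := mul_comm_eq_zero hP.1 hN.1 h0
    have hM : P + N ∈ singularSpace A l := by
      refine h.mem_singularSpace_of_le hl0 hl (hP.1.add hN.1) ?_
      have e1 : ((P + N) * (P + N)).trace = (Z * Z).trace := by
        rw [hPN]
        simp only [add_mul, mul_add, sub_mul, mul_sub, h0, h0']
        simp
      have e2 : (l : ℂ) ^ 2 * (Z * Z).trace = (lmap A Z * lmap A Z).trace := by
        rw [← trace_rmap_mul, (mem_singularSpace.mp hZ).2, smul_mul_assoc, trace_smul, smul_eq_mul]
      -- Passing from `P - N` to `P + N` keeps the norm and adds four times a nonnegative cross term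
      -- to the squared norm of the image.
      have e3 : (lmap A (P + N) * lmap A (P + N)).trace = (lmap A Z * lmap A Z).trace +
          4 * (lmap A P * lmap A N).trace := by
        rw [hPN]
        simp only [map_add, map_sub, add_mul, mul_add, sub_mul, mul_sub, trace_add, trace_sub]
        rw [trace_mul_comm (lmap A N) (lmap A P)]
        ring
      have e4 := (Complex.nonneg_iff.mp (trace_mul_nonneg_of_posSemidef (posSemidef_lmap hA hP)
        (posSemidef_lmap hA hN))).1
      have e5 : l ^ 2 * (Z * Z).trace.re = (lmap A Z * lmap A Z).trace.re := by
        rw [← e2, ← Complex.ofReal_pow, Complex.re_ofReal_mul]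
      rw [e1, e5, e3, Complex.add_re]
      simp only [Complex.mul_re, Complex.re_ofNat, Complex.im_ofNat, zero_mul, sub_zero]
      linarith
    have e6 : P = (2⁻¹ : ℝ) • (Z + (P + N)) := by
      rw [hPN, sub_add_add_cancel, ← two_smul ℝ P, smul_smul]
      norm_num
    rw [e6]
    exact Submodule.smul_mem _ _ (Submodule.add_mem _ hZ hM)
  · obtain ⟨W, hW, hS⟩ := hsp' X hX hXp
    exact mem_singularSpace.mpr ⟨isHermitian_conj (isHermitian_supp X) hZ.1,
      hconj (isIdempotentElem_supp X) hW hS Z hZ⟩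
  · obtain ⟨W, hW, hS⟩ := hsp' X hX hXp
    have hV := isIdempotentElem_supp X
    refine smul_right_injective _ (pow_ne_zero 2 hl1) ?_
    simp only
    rw [← (mem_singularSpace.mp hZ).2, hS.rmap_eq, hS.rmap_conj hV hW, smul_add,
      hS.compl.rmap_conj hV.one_sub hW.one_sub, conj_conj hV, conj_conj hV.one_sub,
      (mem_singularSpace.mp hZ).2]
    simp only [mul_smul_comm, smul_mul_assoc]

theorem linearIndependent_of_trace {ι : Type*} [Fintype ι] [DecidableEq ι] {v : ι → CMat k}
    (h : ∀ i j, (v i * v j).trace = if i = j then 1 else 0) : LinearIndependent ℝ v := by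
  rw [Fintype.linearIndependent_iff]
  intro g hg i
  have h1 := congrArg (fun M => (v i * M).trace) hg
  simpa [Finset.mul_sum, trace_sum, trace_smul, h] using h1

theorem eq_sum_of_mem_span {r : ℕ} {v : Fin r → CMat k}
    (h : ∀ i j, (v i * v j).trace = if i = j then 1 else 0) {Z : CMat k}
    (hZ : Z ∈ Submodule.span ℝ (Set.range v)) : Z = ∑ j, (v j * Z).trace • v j := by
  induction hZ using Submodule.span_induction with
  | mem x hx =>
    obtain ⟨i, rfl⟩ := hx
    simp [h]
  | zero => simp
  | add x y _ _ hx hy =>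
    conv_lhs => rw [hx, hy]
    rw [← Finset.sum_add_distrib]
    exact Finset.sum_congr rfl fun j _ => by rw [mul_add, trace_add, add_smul]
  | smul a x _ hx =>
    conv_lhs => rw [hx]
    rw [Finset.smul_sum]
    exact Finset.sum_congr rfl fun j _ => by rw [mul_smul_comm, trace_smul, smul_assoc]

/-- The positive orthonormal family has exactly `s` elements, since it and the top `γ i` are
linearly independent with the same real span. Its images under `lmap A`, divided by `l`, are again
positive and orthonormal. -/
theorem IsHermitianSchmidt.exists_isSplitData (h : IsHermitianSchmidt A lam γ δ)
    (hA : A.PosSemidef) (hlam : Antitone lam) (hn : 0 < n)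
    (hsp : ∀ l : ℝ, 0 < l → ∀ (X : CMat k) (Y : CMat m), X.PosSemidef → Y.PosSemidef →
      lmap A X = (l : ℂ) • Y → rmap A Y = (l : ℂ) • X → SplitsAlong A (supp X) (supp Y)) :
    ∃ (s : ℕ) (γ' : Fin s → CMat k) (δ' : Fin s → CMat m), IsSplitData A lam γ δ γ' δ' := by
  set l := lam ⟨0, hn⟩ with hldef
  have hl0 : 0 < l := h.pos _
  have hle : ∀ i, lam i ≤ l := fun i => hlam (Nat.zero_le _)
  have hl1 : (l : ℂ) ≠ 0 := by exact_mod_cast hl0.ne'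
  obtain ⟨s, hsn, hs⟩ := HermMat.exists_initial_segment (fun i => lam i = l)
    fun i j hij hj => le_antisymm (hle i) (hj ▸ hlam hij)
  have hs1 : 1 ≤ s := (hs ⟨0, hn⟩).mp rfl
  have htop : ∀ i : Fin n, (i : ℕ) < s → lam i = l := fun i hi => (hs i).mpr hi
  have hgt : ∀ i : Fin n, s ≤ (i : ℕ) → lam i < l := fun i hi =>
    lt_of_le_of_ne (hle i) fun he => absurd ((hs i).mp he) (not_lt.mpr hi)
  have hlat := h.isPosLattice hA hl0 hle (hsp l hl0)
  set g : Fin s → CMat k := fun i => γ (Fin.castLE hsn i) with hg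
  have hgg : ∀ i j, (g i * g j).trace = if i = j then 1 else 0 := fun i j => by
    rw [hg, h.trace_left]
    simp only [Fin.castLE_inj]
  have hgS : ∀ i, g i ∈ singularSpace A l := fun i => by
    refine mem_singularSpace.mpr ⟨h.herm_left _, ?_⟩
    rw [h.lmap_left, map_smul, h.rmap_right, smul_smul, htop _ i.2, sq]
  obtain ⟨T, hT, hTT, hspan⟩ := hlat.exists_orthonormal
  have hTv : ∀ X Y : T, ((X : CMat k) * (Y : CMat k)).trace = if X = Y then 1 else 0 :=
    fun X Y => by
      split_ifs with hXY
      · subst hXY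
        exact (hT X X.2).2.2
      · exact hTT X X.2 Y Y.2 fun he => hXY (Subtype.ext he)
  have hS : singularSpace A l = Submodule.span ℝ (Set.range g) := by
    refine le_antisymm (fun X hX => ?_) (Submodule.span_le.mpr ?_)
    · rw [h.eq_sum_top hl0 htop hgt hX.2]
      refine Submodule.sum_mem _ fun i _ => ?_
      split_ifs with hi
      · rw [← ofReal_re_trace_mul (h.herm_left i) hX.1, Complex.ofReal_one, one_mul]
        exact Submodule.smul_mem _ ((γ i * X).trace.re)
          (Submodule.subset_span ⟨⟨i, hi⟩, rfl⟩)
      · simp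
    · rintro _ ⟨i, rfl⟩
      exact hgS i
  have hcard : T.card = s := by
    have e1 : Submodule.span ℝ (T : Set (CMat k)) = Submodule.span ℝ (Set.range g) := by
      rw [← hS]
      exact le_antisymm (Submodule.span_le.mpr fun X hX => (hT X hX).1) hspan
    have e2 := finrank_span_eq_card (linearIndependent_of_trace hgg)
    have e3 := finrank_span_eq_card (linearIndependent_of_trace hTv)
    have e4 : Set.range (fun X : T => (X : CMat k)) = T := Subtype.range_coe
    rw [e4, e1, e2] at e3
    simpa using e3.symm
  set e := T.equivFinOfCardEq hcard with he
  set γ' : Fin s → CMat k := fun j => (e.symm j : CMat k) with hγ'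
  have hγT : ∀ j, γ' j ∈ T := fun j => (e.symm j).2
  have hγγ : ∀ i j, (γ' i * γ' j).trace = if i = j then 1 else 0 := fun i j => by
    rw [hγ', hTv]
    simp
  have hγS : ∀ j, γ' j ∈ singularSpace A l := fun j => (hT _ (hγT j)).1
  have hγp : ∀ j, (γ' j).PosSemidef := fun j => (hT _ (hγT j)).2.1
  have hrange : Set.range γ' = T := by
    ext X
    constructor
    · rintro ⟨j, rfl⟩
      exact hγT j
    · exact fun hX => ⟨e ⟨X, hX⟩, by simp [hγ']⟩
  have hexp : ∀ i : Fin n, (i : ℕ) < s → γ i = ∑ j, (γ' j * γ i).trace • γ' j := fun i hi =>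
    eq_sum_of_mem_span hγγ (hrange ▸ hspan (hgS ⟨i, hi⟩))
  -- Two orthonormal bases of one space give the same orthogonal projection.
  have hproj : ∀ X : CMat k, ∑ j, (γ' j * X).trace • γ' j =
      ∑ i : Fin n, ((if (i : ℕ) < s then 1 else 0 : ℝ) * (γ i * X).trace : ℂ) • γ i := by
    intro X
    have e1 : ∀ j, (γ' j * X).trace • γ' j = ∑ i : Fin n, ((γ' j * X).trace *
        ((if (i : ℕ) < s then 1 else 0 : ℝ) * (γ i * γ' j).trace : ℂ)) • γ i := fun j => by
      conv_lhs => rw [h.eq_sum_top hl0 htop hgt (hγS j).2, Finset.smul_sum]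
      refine Finset.sum_congr rfl fun i _ => ?_
      rw [smul_smul, ← h.eq_sum_top hl0 htop hgt (hγS j).2]
    rw [Finset.sum_congr rfl fun j _ => e1 j, Finset.sum_comm]
    refine Finset.sum_congr rfl fun i _ => ?_
    rw [← Finset.sum_smul]
    congr 1
    split_ifs with hi
    · conv_rhs => rw [hexp i hi, Finset.sum_mul, trace_sum, Finset.mul_sum]
      refine Finset.sum_congr rfl fun j _ => ?_
      rw [smul_mul_assoc, trace_smul, smul_eq_mul, trace_mul_comm (γ i)]
      push_cast
      ring
    · simp
  set δ' : Fin s → CMat m := fun j => ((l⁻¹ : ℝ) : ℂ) • lmap A (γ' j) with hδ'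
  have hδp : ∀ j, (δ' j).PosSemidef := fun j =>
    (posSemidef_lmap hA (hγp j)).smul (by exact_mod_cast (inv_pos.mpr hl0).le)
  refine ⟨s, γ', δ', ⟨h, hlam, hs1, hsn, fun i j hi hj => (htop i hi).trans (htop j hj).symm,
    fun i j hi hj => (hgt j hj).trans_eq (htop i hi).symm,
    ⟨fun _ => one_pos, fun j => (hγp j).1, fun j => (hδp j).1, fun i j => ?_, fun i j => ?_, ?_⟩,
    hγp, hδp⟩⟩
  · rw [(hγp j).1.eq, hγγ]
  · rw [(hδp j).1.eq, hδ']
    simp only [smul_mul_assoc, mul_smul_comm, trace_smul]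
    rw [← trace_rmap_mul, (hγS j).2, smul_mul_assoc, trace_smul, trace_mul_comm, hγγ,
      Complex.ofReal_inv]
    simp only [smul_eq_mul]
    field_simp
  · refine lmap_injective fun X => ?_
    rw [sum_top_kronecker, lmap_sum_smul_kronecker, lmap_sum_smul_kronecker]
    have e1 : ∑ j, (((1 : ℝ) : ℂ) * (γ' j * X).trace) • δ' j =
        ((l⁻¹ : ℝ) : ℂ) • lmap A (∑ j, (γ' j * X).trace • γ' j) := by
      rw [map_sum, Finset.smul_sum]
      refine Finset.sum_congr rfl fun j _ => ?_
      rw [map_smul, hδ', Complex.ofReal_one, one_mul, smul_comm]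
    rw [e1, hproj, map_sum, Finset.smul_sum]
    refine Finset.sum_congr rfl fun i _ => ?_
    rw [map_smul, h.lmap_left, smul_smul, smul_smul]
    congr 1
    split_ifs with hi
    · rw [htop i hi, Complex.ofReal_inv]
      field_simp
    · simp

end TopEigenspace

/-! ### Iteration of the split decomposition -/

section IteratedSplit

open Matrix

variable {k m n s : ℕ} {A : BiMat k m} {lam : Fin n → ℝ} {γ : Fin n → CMat k}
  {δ : Fin n → CMat m} {γ' : Fin s → CMat k} {δ' : Fin s → CMat m}

theorem IsPPT.splitsAlong_supp (hA : IsPPT A) {l : ℝ} {X : CMat k} {Y : CMat m}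
    (hX : X.PosSemidef) (hY : Y.PosSemidef) (h₁ : lmap A X = (l : ℂ) • Y)
    (h₂ : rmap A Y = (l : ℂ) • X) : SplitsAlong A (supp X) (supp Y) :=
  hA.splitsAlong (isStarProjection_supp X) (isStarProjection_supp Y)
    (mul_supp_kronecker_eq_zero hA.1 hX h₁) (mul_kronecker_supp_eq_zero hA.1 hY h₂)

/-- For SPC `A` the two maps coincide, so `X - Y` satisfies the eigenvector equation for `-l < 0`,
while the quadratic form of `lmap A` is nonnegative. Thus positive singular pairs have equal
members. -/
theorem IsSPC.eq_of_lmap_eq {A : BiMat k k} (hA : IsSPC A) {l : ℝ} (hl : 0 < l) {X Y : CMat k}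
    (hX : X.IsHermitian) (hY : Y.IsHermitian) (h₁ : lmap A X = (l : ℂ) • Y)
    (h₂ : rmap A Y = (l : ℂ) • X) : X = Y := by
  obtain ⟨-, n, lam, γ, h⟩ := hA
  have hlr : ∀ Z, rmap A Z = lmap A Z := fun Z => by rw [h.rmap_apply, h.lmap_apply]
  have hM : (X - Y).IsHermitian := hX.sub hY
  have e1 : lmap A (X - Y) = (-l : ℂ) • (X - Y) := by
    rw [map_sub, h₁, ← hlr Y, h₂, ← smul_sub, ← neg_sub X Y, smul_neg, neg_smul]
  have e2 : (lmap A (X - Y) * (X - Y)).trace =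
      ((∑ i, lam i * (γ i * (X - Y)).trace.re ^ 2 : ℝ) : ℂ) := by
    rw [h.lmap_apply, Finset.sum_mul, trace_sum]
    push_cast
    refine Finset.sum_congr rfl fun i _ => ?_
    rw [smul_mul_assoc, trace_smul, smul_eq_mul, ofReal_re_trace_mul (h.herm_left i) hM]
    ring
  rw [e1, smul_mul_assoc, trace_smul, ← ofReal_re_trace_mul hM hM, smul_eq_mul] at e2
  have e3 : -l * ((X - Y) * (X - Y)).trace.re =
      ∑ i, lam i * (γ i * (X - Y)).trace.re ^ 2 := by exact_mod_cast e2
  have e4 : 0 ≤ ∑ i, lam i * (γ i * (X - Y)).trace.re ^ 2 :=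
    Finset.sum_nonneg fun i _ => mul_nonneg (h.pos i).le (sq_nonneg _)
  by_contra hne
  have e5 := mul_pos hl (re_trace_mul_self_pos hM (sub_ne_zero.mpr hne))
  linarith

theorem IsSPC.splitsAlong_supp {A : BiMat k k} (hA : IsSPC A) {l : ℝ} (hl : 0 < l) {X Y : CMat k}
    (hX : X.PosSemidef) (hY : Y.PosSemidef) (h₁ : lmap A X = (l : ℂ) • Y)
    (h₂ : rmap A Y = (l : ℂ) • X) : SplitsAlong A (supp X) (supp Y) := by
  obtain rfl := hA.eq_of_lmap_eq hl hX.1 hY.1 h₁ h₂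
  exact hA.splitsAlong (isStarProjection_supp X)
    (mul_supp_kronecker_eq_zero hA.1 hX h₁) (mul_kronecker_supp_eq_zero hA.1 hX h₂)

theorem IsSplitData.splitsAlong (h : IsSplitData A lam γ δ γ' δ')
    (hsp : ∀ l : ℝ, 0 < l → ∀ (X : CMat k) (Y : CMat m), X.PosSemidef → Y.PosSemidef →
      lmap A X = (l : ℂ) • Y → rmap A Y = (l : ℂ) • X → SplitsAlong A (supp X) (supp Y))
    (i : Fin s) : SplitsAlong A (supp (γ' i)) (supp (δ' i)) := by
  obtain ⟨l, hl0, hl, -⟩ := h.exists_top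
  exact hsp l hl0 _ _ (h.posSemidef_left i) (h.posSemidef_right i) (h.lmap_top hl i)
    (h.rmap_top hl i)

theorem IsPPT.splitsAlong_splitData (hA : IsPPT A) (h : IsSplitData A lam γ δ γ' δ') (i : Fin s) :
    SplitsAlong A (supp (γ' i)) (supp (δ' i)) :=
  h.splitsAlong (fun _ _ _ _ => hA.splitsAlong_supp) i

theorem IsSPC.splitsAlong_splitData {A : BiMat k k} {γ δ : Fin n → CMat k}
    {γ' δ' : Fin s → CMat k} (hA : IsSPC A) (h : IsSplitData A lam γ δ γ' δ') (i : Fin s) :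
    SplitsAlong A (supp (γ' i)) (supp (δ' i)) :=
  h.splitsAlong (fun _ hl _ _ => hA.splitsAlong_supp hl) i

theorem IsHermitianSchmidt.pos_of_ne_zero (h : IsHermitianSchmidt A lam γ δ) (hA : A ≠ 0) :
    0 < n := by
  rcases Nat.eq_zero_or_pos n with rfl | hn
  · exact absurd (by rw [h.eq_sum, Finset.univ_eq_empty, Finset.sum_empty]) hA
  · exact hn

theorem IsPPT.exists_isSplitData (hA : IsPPT A) (h0 : A ≠ 0) :
    ∃ (n s : ℕ) (lam : Fin n → ℝ) (γ : Fin n → CMat k) (δ : Fin n → CMat m)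
      (γ' : Fin s → CMat k) (δ' : Fin s → CMat m), IsSplitData A lam γ δ γ' δ' := by
  obtain ⟨n, lam, γ, δ, hlam, h⟩ := HermMat.exists_isHermitianSchmidt hA.1.1
  obtain ⟨s, γ', δ', h'⟩ := h.exists_isSplitData hA.1 hlam (h.pos_of_ne_zero h0)
    (fun _ _ _ _ => hA.splitsAlong_supp)
  exact ⟨n, s, lam, γ, δ, γ', δ', h'⟩

theorem IsSPC.exists_isSplitData {A : BiMat k k} (hA : IsSPC A) (h0 : A ≠ 0) :
    ∃ (n s : ℕ) (lam : Fin n → ℝ) (γ : Fin n → CMat k) (γ' : Fin s → CMat k),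
      IsSplitData A lam γ γ γ' γ' := by
  obtain ⟨n, lam, γ, hlam, h⟩ := hA.exists_antitone
  obtain ⟨s, γ', δ', h'⟩ := h.exists_isSplitData hA.1 hlam (h.pos_of_ne_zero h0)
    (fun _ hl _ _ => hA.splitsAlong_supp hl)
  obtain ⟨l, hl0, hl, -⟩ := h'.exists_top
  obtain rfl : γ' = δ' := funext fun i => hA.eq_of_lmap_eq hl0 (h'.posSemidef_left i).1
    (h'.posSemidef_right i).1 (h'.lmap_top hl i) (h'.rmap_top hl i)
  exact ⟨n, s, lam, γ, γ', h'⟩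

/-- This makes the recursion terminate, by finite dimension. The remainder is both `A * Q` and `Q *
A` with `Q = complProj γ' ⊗ complProj δ'`, so it inherits the kernel of `A`; it also kills `supp (γ'
i) ⊗ supp (δ' i)`, which `A` sends to a nonzero piece. -/
theorem IsSplitData.ker_mulLeft_lt (h : IsSplitData A lam γ δ γ' δ') (hA : A.PosSemidef)
    (hsp : ∀ i, SplitsAlong A (supp (γ' i)) (supp (δ' i))) :
    LinearMap.ker (LinearMap.mulLeft ℂ A) <
      LinearMap.ker (LinearMap.mulLeft ℂ (splitRemainder A γ' δ')) := by
  have hR := (h.sum_eq hA hsp).1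
  set V := complProj γ' with hV
  set W := complProj δ' with hW
  have hVh : Vᴴ = V := (isStarProjection_complProj γ').2
  have hWh : Wᴴ = W := (isStarProjection_complProj δ').2
  have hVW : (V ⊗ₖ W).IsHermitian := by rw [IsHermitian, conjTranspose_kronecker, hVh, hWh]
  have hR' : (V ⊗ₖ W) * A = splitRemainder A γ' δ' := by
    have e1 : (splitRemainder A γ' δ').IsHermitian := isHermitian_conj hVW hA.1
    rw [← e1.eq, ← hR, conjTranspose_mul, hVW.eq, hA.1.eq]
  let i : Fin s := ⟨0, h.one_le⟩
  refine lt_of_le_of_ne (fun M hM => ?_) fun he => h.splitPiece_ne_zero i ?_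
  · change splitRemainder A γ' δ' * M = 0
    rw [← hR', Matrix.mul_assoc, show A * M = 0 from hM, Matrix.mul_zero]
  · have e2 : supp (γ' i) ⊗ₖ supp (δ' i) ∈ LinearMap.ker (LinearMap.mulLeft ℂ A) := by
      rw [he]
      change splitRemainder A γ' δ' * _ = 0
      rw [← hR, Matrix.mul_assoc, ← mul_kronecker_mul, mul_comm_eq_zero (isHermitian_supp _) hVh
        (h.supp_mul_complProj_left i), zero_kronecker, Matrix.mul_zero]
    exact ((hsp i).mul_kronecker_eq_compress (isIdempotentElem_supp _)
      (isIdempotentElem_supp _)).symm.trans e2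

theorem isWeakIrreducible_zero : IsWeakIrreducible (0 : BiMat k m) :=
  ⟨PosSemidef.zero, fun _ _ _ _ _ _ _ _ _ _ _ _ _ => Or.inl (by simp [compress])⟩

theorem IsSplitData.eq_sum_append (h : IsSplitData A lam γ δ γ' δ') (hA : A.PosSemidef)
    (hsp : ∀ i, SplitsAlong A (supp (γ' i)) (supp (δ' i))) {L : List (BiMat k m)}
    (hL : splitRemainder A γ' δ' = L.sum) :
    A = (List.ofFn (splitPiece A γ' δ') ++ L).sum := by
  rw [List.sum_append, List.sum_ofFn, ← hL]
  exact (h.sum_eq hA hsp).2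

/-- Since `s ≥ 1`, fewer than two pieces means `s = 1` and an empty tail, so the remainder is zero
and `A` equals its only piece. -/
theorem IsSplitData.isWeakIrreducible_or_two_le (h : IsSplitData A lam γ δ γ' δ')
    (hA : A.PosSemidef) (hsp : ∀ i, SplitsAlong A (supp (γ' i)) (supp (δ' i)))
    {L : List (BiMat k m)} (hL : splitRemainder A γ' δ' = L.sum) :
    IsWeakIrreducible A ∨ 2 ≤ (List.ofFn (splitPiece A γ' δ') ++ L).length := by
  rw [List.length_append, List.length_ofFn]
  have hs := h.one_le
  by_cases h2 : 2 ≤ s + L.length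
  · exact Or.inr h2
  · left
    obtain rfl : s = 1 := by omega
    obtain rfl : L = [] := List.eq_nil_of_length_eq_zero (by omega)
    have h3 := (h.sum_eq hA hsp).2
    rw [hL, List.sum_nil, add_zero, Fin.sum_univ_one] at h3
    rw [h3]
    exact h.isWeakIrreducible_splitPiece hA hsp 0

theorem IsPPT.exists_iteratedSplit {A : BiMat k m} (hA : IsPPT A) :
    ∃ L : List (BiMat k m), IteratedSplitPPT A L := by
  induction hK : LinearMap.ker (LinearMap.mulLeft ℂ A) using WellFoundedGT.induction
    generalizing A with
  | _ K ih =>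
  by_cases h0 : A = 0
  · subst h0
    exact ⟨[], .zero⟩
  obtain ⟨n, s, lam, γ, δ, γ', δ', h⟩ := hA.exists_isSplitData h0
  obtain ⟨L, hL⟩ := ih _ (hK ▸ h.ker_mulLeft_lt hA.1 (hA.splitsAlong_splitData h))
    (hA.compress (isStarProjection_complProj γ').2 (isStarProjection_complProj δ').2) rfl
  exact ⟨_, .step h hL⟩

theorem IsSPC.exists_iteratedSplit {A : BiMat k k} (hA : IsSPC A) :
    ∃ L : List (BiMat k k), IteratedSplitSPC A L := by
  induction hK : LinearMap.ker (LinearMap.mulLeft ℂ A) using WellFoundedGT.induction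
    generalizing A with
  | _ K ih =>
  by_cases h0 : A = 0
  · subst h0
    exact ⟨[], .zero⟩
  obtain ⟨n, s, lam, γ, γ', h⟩ := hA.exists_isSplitData h0
  obtain ⟨L, hL⟩ := ih _ (hK ▸ h.ker_mulLeft_lt hA.1 (hA.splitsAlong_splitData h))
    (hA.compress (isStarProjection_complProj γ').2) rfl
  exact ⟨_, .step h hL⟩

theorem IteratedSplitPPT.conclusion {A : BiMat k m} {L : List (BiMat k m)}
    (h : IteratedSplitPPT A L) (hA : IsPPT A) :
    A = L.sum ∧ (∀ B ∈ L, B ≠ 0 ∧ IsPPT B ∧ IsWeakIrreducible B) ∧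
      (IsWeakIrreducible A ∨ 2 ≤ L.length) := by
  induction h with
  | zero => exact ⟨rfl, by simp, Or.inl isWeakIrreducible_zero⟩
  | @step n s A lam γ δ γ' δ' L h hL ih =>
    have hsp := hA.splitsAlong_splitData h
    obtain ⟨h1, h2, -⟩ := ih
      (hA.compress (isStarProjection_complProj γ').2 (isStarProjection_complProj δ').2)
    refine ⟨h.eq_sum_append hA.1 hsp h1, fun B hB => ?_,
      h.isWeakIrreducible_or_two_le hA.1 hsp h1⟩
    rcases List.mem_append.mp hB with hB | hB
    · obtain ⟨i, rfl⟩ := List.mem_ofFn.mp hB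
      exact ⟨h.splitPiece_ne_zero i, hA.compress (isHermitian_supp _) (isHermitian_supp _),
        h.isWeakIrreducible_splitPiece hA.1 hsp i⟩
    · exact h2 B hB

theorem IteratedSplitSPC.conclusion {A : BiMat k k} {L : List (BiMat k k)}
    (h : IteratedSplitSPC A L) (hA : IsSPC A) :
    A = L.sum ∧ (∀ B ∈ L, B ≠ 0 ∧ IsSPC B ∧ IsWeakIrreducible B) ∧
      (IsWeakIrreducible A ∨ 2 ≤ L.length) := by
  induction h with
  | zero => exact ⟨rfl, by simp, Or.inl isWeakIrreducible_zero⟩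
  | @step n s A lam γ γ' L h hL ih =>
    have hsp := hA.splitsAlong_splitData h
    obtain ⟨h1, h2, -⟩ := ih (hA.compress (isStarProjection_complProj γ').2)
    refine ⟨h.eq_sum_append hA.1 hsp h1, fun B hB => ?_,
      h.isWeakIrreducible_or_two_le hA.1 hsp h1⟩
    rcases List.mem_append.mp hB with hB | hB
    · obtain ⟨i, rfl⟩ := List.mem_ofFn.mp hB
      exact ⟨h.splitPiece_ne_zero i, hA.compress (isHermitian_supp _),
        h.isWeakIrreducible_splitPiece hA.1 hsp i⟩
    · exact h2 B hB

end IteratedSplit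

theorem mainTheorem4 :
    (∀ (k : ℕ) (A : BiMat k k), IsSPC A →
      (∃ L : List (BiMat k k), IteratedSplitSPC A L) ∧
      ∀ L : List (BiMat k k), IteratedSplitSPC A L →
        A = L.sum ∧
        (∀ B ∈ L, B ≠ 0 ∧ IsSPC B ∧ IsWeakIrreducible B) ∧
        (IsWeakIrreducible A ∨ 2 ≤ L.length)) ∧
    (∀ (k m : ℕ) (A : BiMat k m), IsPPT A →
      (∃ L : List (BiMat k m), IteratedSplitPPT A L) ∧
      ∀ L : List (BiMat k m), IteratedSplitPPT A L →
        A = L.sum ∧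
        (∀ B ∈ L, B ≠ 0 ∧ IsPPT B ∧ IsWeakIrreducible B) ∧
        (IsWeakIrreducible A ∨ 2 ≤ L.length)) :=
  ⟨fun _ _ hA => ⟨hA.exists_iteratedSplit, fun _ hL => hL.conclusion hA⟩,
    fun _ _ _ hA => ⟨hA.exists_iteratedSplit, fun _ hL => hL.conclusion hA⟩⟩
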